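/- Let $K$ be a field of characteristic $0$, let $V_1$ be the $SL_2(K)$-module of binary linear forms, and let $\mathcal I = K[5V_1]^{SL_2}$ be the algebra of $SL_2(K)$-invariant polynomial functions on quintuples $(\ell_1,\dots,\ell_5)$ of binary linear forms $\ell_i = a_{i0}x + a_{i1}y$, graded by total degree in the coefficients. (1) The ten brackets $[ij] = a_{i0}a_{j1}-a_{i1}a_{j0}$, $1\le i<j\le 5$, form a minimal system of homogeneous generators of $\mathcal I$ (they are homogeneous of degree $2$, generate $\mathcal I$, and none lies in the subalgebra generated by the others). (2) The kernel of the $K$-algebra homomorphism $K[x_{ij} : 1\le i<j\le 5]\to\mathcal I$, $x_{ij}\mapsto [ij]$, is generated as an ideal by the five Plücker relations of $G(2,5)$ $$x_{ij}x_{kl}-x_{ik}x_{jl}+x_{il}x_{jk},\qquad 1\le i<j<k<l\le 5,$$ that is, by the $4\times4$ sub-Pfaffians of the generic skew-symmetric $5\times 5$ matrix, and none of the five lies in the ideal generated by the others. (3) Let $f_1,\dots,f_m$ be any minimal system of homogeneous generators of $\mathcal I$. Then $m=10$ and $\deg f_s=2$ for all $s$. Let $R=K[x_1,\dots,x_{10}]$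 with $\deg x_s=\deg f_s=2$, and regard $\mathcal I$ as an $R$-module through the homomorphism $\varphi\colon R\to\mathcal I$, $x_s\mapsto f_s$. Then $\mathcal I$ has a minimal graded free resolution of the form $$0\longrightarrow R(-10)\longrightarrow R(-6)^5\longrightarrow R(-4)^5\longrightarrow R\stackrel{\varphi}{\longrightarrow}\mathcal I\longrightarrow 0,$$ that is, an exact sequence of degree-preserving $R$-linear maps in which the image of each map between free modules is contained in $(x_1,\dots,x_{10})$ times its target. The projective dimension of the $R$-module $\mathcal I$ is $3$. -/

import Mathlib

open MvPolynomial Matrix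

noncomputable section

namespace FiveLinearForms

universe u

/-- The binary linear form `a 0 * x + a 1 * y` with coefficient vector `a`. -/
def linearForm {K : Type u} [Field K] (a : Fin 2 → K) : MvPolynomial (Fin 2) K :=
  ∑ b, C (a b) * X b

/-- The action of `SL₂(K)` on binary forms by the linear substitution `(x, y) ↦ (x, y) g`. -/
def substitute {K : Type u} [Field K] (g : Matrix.SpecialLinearGroup (Fin 2) K) :
    MvPolynomial (Fin 2) K →ₐ[K] MvPolynomial (Fin 2) K :=
  aeval fun b => ∑ c, C ((g : Matrix (Fin 2) (Fin 2) K) c b) * X c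

/-- On coefficient vectors of linear forms, the substitution action is `a ↦ g a`. -/
theorem substitute_linearForm {K : Type u} [Field K] (g : Matrix.SpecialLinearGroup (Fin 2) K)
    (a : Fin 2 → K) :
    substitute g (linearForm a) = linearForm ((g : Matrix (Fin 2) (Fin 2) K) *ᵥ a) := by
  simp [substitute, linearForm, Matrix.mulVec, dotProduct, Fin.sum_univ_two]
  ring

/-- The algebra `K[n V₁]^{SL₂}` of invariant polynomial functions on `n`-tuples of binary linear
forms; the variable `(i, b)` is the `b`-th coefficient of the `i`-th form. -/
def invariants (K : Type u) [Field K] (n : ℕ) :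
    Subalgebra K (MvPolynomial (Fin n × Fin 2) K) where
  carrier := {p | ∀ (g : Matrix.SpecialLinearGroup (Fin 2) K) (v : Fin n → Fin 2 → K),
    eval (fun q => ((g : Matrix (Fin 2) (Fin 2) K) *ᵥ v q.1) q.2) p
      = eval (fun q => v q.1 q.2) p}
  mul_mem' := by
    intro p q hp hq g v
    rw [map_mul, map_mul, hp g v, hq g v]
  add_mem' := by
    intro p q hp hq g v
    rw [map_add, map_add, hp g v, hq g v]
  algebraMap_mem' := by
    intro r g v
    simp [MvPolynomial.algebraMap_eq]

/-- The bracket `[i j]`, the determinant of the coefficients of the `i`-th and `j`-th form. -/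
def bracket (K : Type u) [Field K] {n : ℕ} (i j : Fin n) : invariants K n :=
  ⟨X (i, 0) * X (j, 1) - X (i, 1) * X (j, 0), by
    intro g v
    have h : g.1 0 0 * g.1 1 1 - g.1 0 1 * g.1 1 0 = 1 := by
      rw [← Matrix.det_fin_two]; exact g.2
    simp only [map_sub, map_mul, eval_X, Matrix.mulVec, dotProduct, Fin.sum_univ_two]
    linear_combination (v i 0 * v j 1 - v i 1 * v j 0) * h⟩

/-- The index set `{(i, j) : i < j}` of the ten brackets of five linear forms. -/
abbrev Pair : Type := {p : Fin 5 × Fin 5 // p.1 < p.2}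

/-- The family of the ten brackets `[i j]`, `i < j`. -/
def brackets (K : Type u) [Field K] : Pair → invariants K 5 :=
  fun p => bracket K p.1.1 p.1.2

/-- The generic skew-symmetric `5 × 5` matrix in the variables `x_{ij}`, `i < j`. -/
def genericSkew (K : Type u) [Field K] : Matrix (Fin 5) (Fin 5) (MvPolynomial Pair K) :=
  fun i j => if h : i < j then X ⟨(i, j), h⟩ else if h : j < i then -X ⟨(j, i), h⟩ else 0

/-- The Pfaffian of a skew-symmetric `4 × 4` matrix. -/
def pfaffianFour {R : Type*} [CommRing R] (A : Matrix (Fin 4) (Fin 4) R) : R :=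
  A 0 1 * A 2 3 - A 0 2 * A 1 3 + A 0 3 * A 1 2

/-- The Plücker relation of `G(2,5)` belonging to the four indices different from `h`: the Pfaffian
of the generic skew-symmetric matrix with row and column `h` removed. -/
def plucker (K : Type u) [Field K] (h : Fin 5) : MvPolynomial Pair K :=
  pfaffianFour ((genericSkew K).submatrix h.succAbove h.succAbove)

/-- `f` is a minimal system of homogeneous generators, of degrees `deg`, of the algebra `A`. -/
structure IsMinimalGenerators {K : Type u} [Field K] {τ : Type*}
    {A : Subalgebra K (MvPolynomial τ K)} {σ : Type*} (f : σ → A) (deg : σ → ℕ) : Prop where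
  homogeneous : ∀ s, (f s : MvPolynomial τ K).IsHomogeneous (deg s)
  generates : Algebra.adjoin K (Set.range f) = ⊤
  irredundant : ∀ s, f s ∉ Algebra.adjoin K (f '' {s}ᶜ)

/-- The elements of degree `n` of an algebra of polynomials, graded by total degree (with degrees
in `ℤ`; only `0` has negative degree). -/
def algebraDegree {K : Type u} [Field K] {τ : Type*} (A : Subalgebra K (MvPolynomial τ K)) (n : ℤ) :
    Set A :=
  {x | IsWeightedHomogeneous (fun _ : τ => (1 : ℤ)) (x : MvPolynomial τ K) n}

/-- The elements of degree `n` of the graded free module `⨁ₐ R(-t a)` over the polynomial ring `R`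
whose variables have the degrees `w`. -/
def freeDegree {K : Type u} [Field K] {σ : Type*} (w : σ → ℤ) {ι : Type*} (t : ι → ℤ) (n : ℤ) :
    Set (ι → MvPolynomial σ K) :=
  {v | ∀ a, IsWeightedHomogeneous w (v a) (n - t a)}

/-- A minimal graded free resolution, with terms of finite rank,
`⋯ ⟶ F₂ ⟶ F₁ ⟶ F₀ ⟶ M ⟶ 0` of the module `M`, where `Fᵢ = ⨁ₐ R(-twist i a)`. The set `gr n`
consists of the elements of degree `n` of `M`, and `w` gives the (positive) degrees of the
variables of `R`. -/
structure MinimalGradedFreeResolution {K : Type u} [Field K] {σ : Type*} (w : σ → ℤ)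
    (M : Type*) [AddCommGroup M] [Module (MvPolynomial σ K) M] (gr : ℤ → Set M) where
  rank : ℕ → ℕ
  twist : ∀ i, Fin (rank i) → ℤ
  d : ∀ i, (Fin (rank (i + 1)) → MvPolynomial σ K) →ₗ[MvPolynomial σ K]
    (Fin (rank i) → MvPolynomial σ K)
  aug : (Fin (rank 0) → MvPolynomial σ K) →ₗ[MvPolynomial σ K] M
  d_graded : ∀ i n, Set.MapsTo (d i) (freeDegree w (twist (i + 1)) n) (freeDegree w (twist i) n)
  aug_graded : ∀ n, Set.MapsTo aug (freeDegree w (twist 0) n) (gr n)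
  exact_d : ∀ i, Function.Exact (d (i + 1)) (d i)
  exact_aug : Function.Exact (d 0) aug
  aug_surjective : Function.Surjective aug
  minimal : ∀ i v a, d i v a ∈ Ideal.span (Set.range (X : σ → MvPolynomial σ K))

/-- The `i`-th term of the resolution is `R(-j)^r`. -/
def MinimalGradedFreeResolution.TermIs {K : Type u} [Field K] {σ : Type*} {w : σ → ℤ}
    {M : Type*} [AddCommGroup M] [Module (MvPolynomial σ K) M] {gr : ℤ → Set M}
    (F : MinimalGradedFreeResolution (K := K) w M gr) (i : ℕ) (j : ℤ) (r : ℕ) : Prop :=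
  F.rank i = r ∧ ∀ a, F.twist i a = j

/-- The structure of a module over `R = K[x_s : s ∈ σ]` on an algebra `A` that is given by
`x_s ↦ f s`. -/
abbrev moduleVia {K : Type u} [Field K] {A : Type*} [CommRing A] [Algebra K A] {σ : Type*}
    (f : σ → A) : Module (MvPolynomial σ K) A :=
  Module.compHom A (aeval f : MvPolynomial σ K →ₐ[K] A).toRingHom

end FiveLinearForms

end

open FiveLinearForms

/-!
A skew-symmetric `5 × 5` matrix `S` with the row `n` of its signed sub-Pfaffians gives a complex
`R ⟶ R⁵ ⟶ R⁵ ⟶ R` with the maps `nᵀ`, `S`, `n`, and everything rests on its exactness for the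
generic matrix. When the five variables on the sides of a pentagon are kept and the five on its
diagonals are set to zero, the sub-Pfaffians become monomials and exactness can be checked by hand;
the diagonals are then put back one at a time, a homogeneous relation being lifted through a
variable degree by degree. The same exactness shows that each diagonal variable is a nonzerodivisor
modulo the ideal of sub-Pfaffians.

A polynomial in the `x_ij` that vanishes at the brackets of all quintuples of vectors lies in the
Plücker ideal: modulo the Plücker relations a power of `x₀₁` moves it into the variables `x₀ⱼ`,
`x₁ⱼ`, whose brackets can be prescribed freely, and `x₀₁` is a nonzerodivisor. On the section
`x₀₁ = 0` the same argument works with `x₀₂`.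

Moving the first two vectors to standard position by `SL₂` writes an invariant as a polynomial in
the brackets divided by a power of `[01]`. The numerator vanishes where `[01]` does, so it lies in
the ideal generated by `x₀₁` and the Plücker relations, and the power cancels.

A minimal system of generators differs from the brackets by an invertible linear change of
variables, through which the Pfaffian resolution is transported. By Nakayama's argument a minimal
resolution has the shortest possible length, which gives the projective dimension.
-/

noncomputable section

namespace FiveLinearForms

universe u v

section ExactModulo

variable {R S : Type*} [CommRing R] [CommRing S] {ι κ μ : Type*} [Fintype ι] [Fintype κ]

/-- Exactness in the middle of `R^κ ⟶ R^ι ⟶ R^μ`, with matrices `M` and `N`, after reduction modulo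
the ideal `J`; that the composition vanishes is not part of the notion. -/
def ExactModulo (J : Ideal R) (M : Matrix ι κ R) (N : Matrix μ ι R) : Prop :=
  ∀ u : ι → R, (∀ i, (N *ᵥ u) i ∈ J) → ∃ w : κ → R, ∀ i, u i - (M *ᵥ w) i ∈ J

theorem mulVec_mem {J : Ideal R} (N : Matrix μ ι R) {v : ι → R} (hv : ∀ j, v j ∈ J) (i : μ) :
    (N *ᵥ v) i ∈ J :=
  sum_mem fun j _ => J.mul_mem_left _ (hv j)

theorem ExactModulo.of_map {F : Type*} [FunLike F R S] [RingHomClass F R S] {φ : F}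
    (hφ : Function.Surjective φ) {J : Ideal S} {M : Matrix ι κ R} {N : Matrix μ ι R}
    (h : ExactModulo J (M.map φ) (N.map φ)) :
    ExactModulo (J.comap φ) M N := by
  intro u hu
  obtain ⟨w, hw⟩ := h (φ ∘ u) fun i => (φ : R →+* S).map_mulVec N u i ▸ hu i
  obtain ⟨w, rfl⟩ := hφ.comp_left w
  refine ⟨w, fun i => ?_⟩
  rw [Ideal.mem_comap, map_sub]
  exact (φ : R →+* S).map_mulVec M w i ▸ hw i

theorem ExactModulo.bot_of_map {F : Type*} [FunLike F R S] [RingHomClass F R S] {φ : F}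
    (hφ : Function.Bijective φ) {M : Matrix ι κ R} {N : Matrix μ ι R}
    (h : ExactModulo ⊥ (M.map φ) (N.map φ)) : ExactModulo ⊥ M N :=
  Ideal.comap_bot_of_injective φ hφ.injective ▸ h.of_map hφ.surjective

theorem ExactModulo.function_exact {M : Matrix ι κ R} {N : Matrix μ ι R} (hNM : N * M = 0)
    (h : ExactModulo ⊥ M N) : Function.Exact M.mulVecLin N.mulVecLin := by
  intro u
  constructor
  · intro hu
    obtain ⟨w, hw⟩ := h u fun i => congrFun hu i
    exact ⟨w, funext fun i => (sub_eq_zero.1 (hw i)).symm⟩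
  · rintro ⟨w, rfl⟩
    simp [mulVec_mulVec, hNM]

theorem ExactModulo.exists_sub_sub_mul_mem {J : Ideal R} {x : R} {M : Matrix ι κ R}
    {N : Matrix μ ι R} (h : ExactModulo (J ⊔ Ideal.span {x}) M N) {u : ι → R}
    (hu : ∀ i, (N *ᵥ u) i ∈ J ⊔ Ideal.span {x}) :
    ∃ (w : κ → R) (v : ι → R), ∀ i, u i - (M *ᵥ w) i - x * v i ∈ J := by
  obtain ⟨w, hw⟩ := h u hu
  choose a ha b hb hab using fun i => Submodule.mem_sup.1 (hw i)
  choose v hv using fun i => Ideal.mem_span_singleton'.1 (hb i)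
  refine ⟨w, v, fun i => ?_⟩
  rw [← hab i, ← hv i, mul_comm x, add_sub_cancel_right]
  exact ha i

theorem mem_of_pow_mul_mem {J : Ideal R} {x : R} (hx : ∀ f, x * f ∈ J → f ∈ J) {k : ℕ} {f : R}
    (hf : x ^ k * f ∈ J) : f ∈ J := by
  induction k with
  | zero => simpa using hf
  | succ k ih => exact ih (hx _ (by rwa [pow_succ', mul_assoc] at hf))

theorem mulVec_sub_mulVec_sub_smul {M : Matrix ι κ R} {N : Matrix μ ι R} (hNM : N * M = 0)
    (u v : ι → R) (w : κ → R) (r : R) :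
    N *ᵥ (fun i => u i - (M *ᵥ w) i - r * v i) = N *ᵥ u - r • (N *ᵥ v) := by
  rw [← mulVec_smul, ← sub_zero (N *ᵥ u), ← zero_mulVec w, ← hNM, ← mulVec_mulVec,
    ← mulVec_sub, ← mulVec_sub]
  rfl

theorem ExactModulo.exists_sub_sub_pow_mul_mem {J : Ideal R} {x : R} {M : Matrix ι κ R}
    {N : Matrix μ ι R} (h : ExactModulo (J ⊔ Ideal.span {x}) M N) (hNM : N * M = 0)
    (hx : ∀ f, x * f ∈ J → f ∈ J) {u : ι → R} (hu : ∀ i, (N *ᵥ u) i ∈ J) (k : ℕ) :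
    ∃ (w : κ → R) (v : ι → R), ∀ i, u i - (M *ᵥ w) i - x ^ k * v i ∈ J := by
  induction k with
  | zero => exact ⟨0, u, by simp⟩
  | succ k ih =>
    obtain ⟨w, v, hwv⟩ := ih
    have hv : ∀ i, (N *ᵥ v) i ∈ J := fun i => by
      have hdiff := sub_mem (hu i) (mulVec_mem N hwv i)
      rw [mulVec_sub_mulVec_sub_smul hNM] at hdiff
      exact mem_of_pow_mul_mem hx (k := k) (by simpa using hdiff)
    obtain ⟨w', v', hwv'⟩ := h.exists_sub_sub_mul_mem fun i => J.mem_sup_left (hv i)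
    refine ⟨w + x ^ k • w', v', fun i => ?_⟩
    convert add_mem (hwv i) (J.mul_mem_left (x ^ k) (hwv' i)) using 1
    rw [mulVec_add, mulVec_smul, Pi.add_apply, Pi.smul_apply, smul_eq_mul]
    ring

theorem replicateRow_mulVec_apply (n u : ι → R) (i : Fin 1) :
    (replicateRow (Fin 1) n *ᵥ u) i = ∑ j, u j * n j :=
  Finset.sum_congr rfl fun _ _ => mul_comm _ _

theorem ExactModulo.mem_span_sup_of_mul_mem {J : Ideal R} {x : R} {M : Matrix ι κ R} {n : ι → R}
    (h : ExactModulo (J ⊔ Ideal.span {x}) M (replicateRow (Fin 1) n))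
    (hnM : replicateRow (Fin 1) n * M = 0) (hx : ∀ f, x * f ∈ J → f ∈ J) {f : R}
    (hf : x * f ∈ Ideal.span (Set.range n) ⊔ J) : f ∈ Ideal.span (Set.range n) ⊔ J := by
  obtain ⟨g, hg, j, hj, hgj⟩ := Submodule.mem_sup.1 hf
  obtain ⟨c, rfl⟩ := Ideal.mem_span_range_iff_exists_fun.1 hg
  obtain ⟨w, v, hwv⟩ := h.exists_sub_sub_mul_mem (u := c) fun i => by
    rw [replicateRow_mulVec_apply, eq_sub_of_add_eq hgj]
    exact sub_mem (Ideal.mem_sup_right (Ideal.mul_mem_right _ _ (Ideal.mem_span_singleton_self x)))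
      (Ideal.mem_sup_left hj)
  have hfv : f - ∑ i, v i * n i ∈ J := hx _ <| by
    have hdiff := mulVec_mem (replicateRow (Fin 1) n) hwv 0
    rw [mulVec_sub_mulVec_sub_smul hnM, Pi.sub_apply, Pi.smul_apply, smul_eq_mul,
      replicateRow_mulVec_apply, replicateRow_mulVec_apply] at hdiff
    convert add_mem hdiff hj using 1
    rw [mul_sub, ← hgj]
    ring
  rw [← add_sub_cancel (∑ i, v i * n i) f]
  exact add_mem (Ideal.mem_sup_left (Ideal.mem_span_range_iff_exists_fun.2 ⟨v, rfl⟩))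
    (Ideal.mem_sup_right hfv)

end ExactModulo

section GradedDescent

attribute [local instance] MvPolynomial.gradedAlgebra

variable {R σ : Type*} [CommRing R]

/-- The sum of the homogeneous components of degree less than `D`. -/
def lowDegreePart (D : ℕ) : MvPolynomial σ R →ₗ[R] MvPolynomial σ R :=
  ∑ n ∈ Finset.range D, homogeneousComponent n

theorem lowDegreePart_apply (D : ℕ) (p : MvPolynomial σ R) :
    lowDegreePart D p = ∑ n ∈ Finset.range D, homogeneousComponent n p :=
  LinearMap.sum_apply _ _ _

theorem lowDegreePart_eq_self {D : ℕ} {p : MvPolynomial σ R} (hD : p.totalDegree < D) :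
    lowDegreePart D p = p := by
  conv_rhs => rw [← sum_homogeneousComponent p]
  rw [lowDegreePart_apply]
  refine (Finset.sum_subset (Finset.range_subset_range.2 hD) fun n _ hn => ?_).symm
  exact homogeneousComponent_eq_zero _ _ (by simpa using hn)

theorem lowDegreePart_mul {a : ℕ} {m : MvPolynomial σ R} (hm : m.IsHomogeneous a) (D : ℕ)
    (p : MvPolynomial σ R) : lowDegreePart (a + D) (m * p) = m * lowDegreePart D p := by
  have hm' : m ∈ homogeneousSubmodule σ R a := hm
  have hlow : ∀ n ∈ Finset.range a, homogeneousComponent n (m * p) = 0 := fun n hn => by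
    rw [← decomposition.decompose'_apply]
    exact DirectSum.coe_decompose_mul_of_left_mem_of_not_le _ hm' (by simpa using hn)
  have hhigh : ∀ n, homogeneousComponent (a + n) (m * p) = m * homogeneousComponent n p :=
    fun n => by
      rw [← decomposition.decompose'_apply, ← decomposition.decompose'_apply]
      exact DirectSum.coe_decompose_mul_add_of_left_mem _ hm'
  rw [lowDegreePart_apply, Finset.sum_range_add, Finset.sum_eq_zero hlow, zero_add,
    lowDegreePart_apply, Finset.mul_sum]
  exact Finset.sum_congr rfl fun n _ => hhigh n

theorem lowDegreePart_mem {J : Ideal (MvPolynomial σ R)}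
    (hJ : J.IsHomogeneous (homogeneousSubmodule σ R)) {p : MvPolynomial σ R} (hp : p ∈ J) (D : ℕ) :
    lowDegreePart D p ∈ J := by
  rw [lowDegreePart_apply]
  exact sum_mem fun n _ => homogeneousComponent_mem_of_mem hJ hp n

theorem ExactModulo.of_sup_span {ι κ μ : Type*} [Fintype ι] [Fintype κ]
    {J : Ideal (MvPolynomial σ R)} (hJ : J.IsHomogeneous (homogeneousSubmodule σ R))
    {x : MvPolynomial σ R} {d : ℕ} (hxd : x.IsHomogeneous d) (hd : d ≠ 0)
    (hx : ∀ f, x * f ∈ J → f ∈ J) {M : Matrix ι κ (MvPolynomial σ R)}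
    {N : Matrix μ ι (MvPolynomial σ R)} {a : ℕ} (hM : ∀ i j, (M i j).IsHomogeneous a)
    (hNM : N * M = 0) (h : ExactModulo (J ⊔ Ideal.span {x}) M N) : ExactModulo J M N := by
  intro u hu
  obtain ⟨D, hD⟩ : ∃ D, ∀ i, (u i).totalDegree < D :=
    ⟨(Finset.univ.sup fun i => (u i).totalDegree) + 1, fun i =>
      Nat.lt_succ_of_le (Finset.le_sup (f := fun i => (u i).totalDegree) (Finset.mem_univ i))⟩
  obtain ⟨w, v, hwv⟩ := h.exists_sub_sub_pow_mul_mem hNM hx hu (a + D)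
  obtain ⟨E, hE⟩ := Nat.exists_eq_add_of_le (Nat.le_mul_of_pos_left (a + D) hd.bot_lt)
  refine ⟨fun j => lowDegreePart (D + E) (w j), fun i => ?_⟩
  have hu' : lowDegreePart (d * (a + D)) (u i) = u i :=
    lowDegreePart_eq_self ((hD i).trans_le (by omega))
  have hM' : lowDegreePart (d * (a + D)) ((M *ᵥ w) i) =
      (M *ᵥ fun j => lowDegreePart (D + E) (w j)) i := by
    simp only [mulVec, dotProduct, map_sum, hE, add_assoc, lowDegreePart_mul (hM i _)]
  have hx' : lowDegreePart (d * (a + D)) (x ^ (a + D) * v i) = 0 := by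
    rw [← add_zero (d * (a + D)), lowDegreePart_mul (hxd.pow _), lowDegreePart_apply]
    simp
  simpa [hu', hM', hx'] using lowDegreePart_mem hJ (hwv i) (d * (a + D))

end GradedDescent

section VariableIdeals

attribute [local instance] MvPolynomial.gradedAlgebra

variable {R σ τ : Type*} [CommRing R]

theorem mem_span_X_image_of_X_mul_mem {T : Set σ} {y : σ} (hy : y ∉ T) {f : MvPolynomial σ R}
    (hf : X y * f ∈ Ideal.span (X '' T)) : f ∈ Ideal.span (X '' T) := by
  rw [mem_ideal_span_X_image] at hf ⊢
  intro m hm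
  obtain ⟨i, hi, hmi⟩ := hf (Finsupp.single y 1 + m) <| by
    rw [mem_support_iff] at hm ⊢
    rwa [coeff_X_mul]
  have hiy : y ≠ i := fun h => hy (h ▸ hi)
  exact ⟨i, hi, by simpa [Finsupp.single_apply, hiy] using hmi⟩

theorem isHomogeneous_span_X_image (T : Set σ) :
    (Ideal.span (X '' T)).IsHomogeneous (homogeneousSubmodule σ R) := by
  refine Ideal.homogeneous_span _ _ ?_
  rintro _ ⟨y, -, rfl⟩
  exact ⟨1, isHomogeneous_X R y⟩

theorem killCompl_X {f : τ → σ} (hf : Function.Injective f) (i : τ) :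
    killCompl hf (X (f i) : MvPolynomial σ R) = X i := by
  rw [← rename_X, killCompl_rename_app]

theorem killCompl_X_of_notMem_range {f : τ → σ} (hf : Function.Injective f) {y : σ}
    (hy : y ∉ Set.range f) : killCompl hf (X y : MvPolynomial σ R) = 0 := by
  rw [killCompl, aeval_X, dif_neg hy]

theorem ker_killCompl {f : τ → σ} (hf : Function.Injective f) :
    RingHom.ker (killCompl hf : MvPolynomial σ R →ₐ[R] MvPolynomial τ R) =
      Ideal.span (X '' (Set.range f)ᶜ) := by
  set J : Ideal (MvPolynomial σ R) := Ideal.span (X '' (Set.range f)ᶜ)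
  have hmod : (Ideal.Quotient.mkₐ R J).comp ((rename f).comp (killCompl hf)) =
      Ideal.Quotient.mkₐ R J := by
    refine algHom_ext fun y => ?_
    by_cases hy : y ∈ Set.range f
    · obtain ⟨i, rfl⟩ := hy
      simp [killCompl_X hf]
    · have hXy : X y ∈ J := Ideal.subset_span ⟨y, hy, rfl⟩
      simpa [killCompl_X_of_notMem_range hf hy] using (Ideal.Quotient.eq_zero_iff_mem.2 hXy).symm
  refine le_antisymm (fun P hP => ?_) (Ideal.span_le.2 ?_)
  · rw [← Ideal.Quotient.eq_zero_iff_mem, ← Ideal.Quotient.mkₐ_eq_mk R, ← hmod,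
      AlgHom.comp_apply, AlgHom.comp_apply, (RingHom.mem_ker).1 hP, map_zero, map_zero]
  · rintro _ ⟨y, hy, rfl⟩
    exact killCompl_X_of_notMem_range hf hy

theorem ExactModulo.of_span_X_image_union {ι κ μ : Type*} [Fintype ι] [Fintype κ] {T U : Set σ}
    (hU : U.Finite) {M : Matrix ι κ (MvPolynomial σ R)} {N : Matrix μ ι (MvPolynomial σ R)}
    {a : ℕ} (hM : ∀ i j, (M i j).IsHomogeneous a) (hNM : N * M = 0)
    (h : ExactModulo (Ideal.span (X '' (T ∪ U))) M N) : ExactModulo (Ideal.span (X '' T)) M N := by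
  induction U, hU using Set.Finite.induction_on generalizing T with
  | empty => rwa [Set.union_empty] at h
  | @insert y U _ _ ih =>
    have hy : ExactModulo (Ideal.span (X '' insert y T)) M N :=
      ih (by rwa [Set.insert_union, ← Set.union_insert])
    by_cases hyT : y ∈ T
    · rwa [Set.insert_eq_of_mem hyT] at hy
    · rw [Set.image_insert_eq, Ideal.span_insert, sup_comm] at hy
      exact hy.of_sup_span (isHomogeneous_span_X_image T) (isHomogeneous_X R y) one_ne_zero
        (fun f => mem_span_X_image_of_X_mul_mem hyT) hM hNM

theorem ExactModulo.of_map_killCompl [Finite σ] {ι κ μ : Type*} [Fintype ι] [Fintype κ]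
    {f : τ → σ} (hf : Function.Injective f) {T : Set σ} (hT : T ⊆ (Set.range f)ᶜ)
    {M : Matrix ι κ (MvPolynomial σ R)} {N : Matrix μ ι (MvPolynomial σ R)} {a : ℕ}
    (hM : ∀ i j, (M i j).IsHomogeneous a) (hNM : N * M = 0)
    (h : ExactModulo ⊥ (M.map (killCompl hf)) (N.map (killCompl hf))) :
    ExactModulo (Ideal.span (X '' T)) M N := by
  refine .of_span_X_image_union (Set.toFinite (Set.range f)ᶜ) hM hNM ?_
  rw [Set.union_eq_right.2 hT, ← ker_killCompl hf]
  exact .of_map (fun P => ⟨rename f P, killCompl_rename_app hf P⟩) h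

end VariableIdeals

section Pfaffians

variable {S T : Type*} [CommRing S] [CommRing T]

/-- The index of the bracket `[i j]`; the indices run from `0` to `4`. -/
abbrev pair (i j : Fin 5) (h : i < j := by decide) : Pair := ⟨(i, j), h⟩

theorem forall_pair {P : Pair → Prop} (h01 : P (pair 0 1)) (h02 : P (pair 0 2))
    (h03 : P (pair 0 3)) (h04 : P (pair 0 4)) (h12 : P (pair 1 2)) (h13 : P (pair 1 3))
    (h14 : P (pair 1 4)) (h23 : P (pair 2 3)) (h24 : P (pair 2 4)) (h34 : P (pair 3 4))
    (p : Pair) : P p := by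
  obtain ⟨⟨i, j⟩, hij⟩ := p
  fin_cases i <;> fin_cases j <;> first | assumption | exact absurd hij (by decide)

/-- The skew-symmetric matrix with entries `x` above the diagonal. -/
def skewMatrix (x : Pair → S) : Matrix (Fin 5) (Fin 5) S :=
  fun i j => if h : i < j then x ⟨(i, j), h⟩ else if h : j < i then -x ⟨(j, i), h⟩ else 0

/-- The `4 × 4` sub-Pfaffians of a skew-symmetric matrix, with the alternating signs that make them
a null vector of the matrix. -/
def signedPfaffian (x : Pair → S) (h : Fin 5) : S :=
  (-1) ^ (h : ℕ) * pfaffianFour ((skewMatrix x).submatrix h.succAbove h.succAbove)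

theorem skewMatrix_eq (x : Pair → S) : skewMatrix x =
    !![0, x (pair 0 1), x (pair 0 2), x (pair 0 3), x (pair 0 4);
      -x (pair 0 1), 0, x (pair 1 2), x (pair 1 3), x (pair 1 4);
      -x (pair 0 2), -x (pair 1 2), 0, x (pair 2 3), x (pair 2 4);
      -x (pair 0 3), -x (pair 1 3), -x (pair 2 3), 0, x (pair 3 4);
      -x (pair 0 4), -x (pair 1 4), -x (pair 2 4), -x (pair 3 4), 0] := by
  ext i j
  fin_cases i <;> fin_cases j <;> simp [skewMatrix, pair]

theorem signedPfaffian_eq (x : Pair → S) : signedPfaffian x =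
    ![x (pair 1 2) * x (pair 3 4) - x (pair 1 3) * x (pair 2 4) + x (pair 1 4) * x (pair 2 3),
      -(x (pair 0 2) * x (pair 3 4) - x (pair 0 3) * x (pair 2 4) + x (pair 0 4) * x (pair 2 3)),
      x (pair 0 1) * x (pair 3 4) - x (pair 0 3) * x (pair 1 4) + x (pair 0 4) * x (pair 1 3),
      -(x (pair 0 1) * x (pair 2 4) - x (pair 0 2) * x (pair 1 4) + x (pair 0 4) * x (pair 1 2)),
      x (pair 0 1) * x (pair 2 3) - x (pair 0 2) * x (pair 1 3) + x (pair 0 3) * x (pair 1 2)] := by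
  ext h
  fin_cases h <;> simp [signedPfaffian, pfaffianFour, skewMatrix_eq, Fin.succAbove, Fin.lt_def]
  · ring
  · ring

theorem replicateRow_signedPfaffian_mul_skewMatrix (x : Pair → S) :
    replicateRow (Fin 1) (signedPfaffian x) * skewMatrix x = 0 := by
  ext i j
  simp only [Matrix.mul_apply, replicateRow_apply, Fin.sum_univ_five, signedPfaffian_eq,
    skewMatrix_eq]
  fin_cases j <;> simp only [Fin.reduceFinMk, Fin.zero_eta, Fin.mk_one, of_apply, cons_val',
    cons_val, Matrix.zero_apply] <;> ring

theorem skewMatrix_mul_replicateCol_signedPfaffian (x : Pair → S) :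
    skewMatrix x * replicateCol (Fin 1) (signedPfaffian x) = 0 := by
  ext i j
  simp only [Matrix.mul_apply, replicateCol_apply, Fin.sum_univ_five, signedPfaffian_eq,
    skewMatrix_eq]
  fin_cases i <;> simp only [Fin.reduceFinMk, Fin.zero_eta, Fin.mk_one, of_apply, cons_val',
    cons_val, Matrix.zero_apply] <;> ring

theorem skewMatrix_map {F : Type*} [FunLike F S T] [RingHomClass F S T] (φ : F)
    (x : Pair → S) : (skewMatrix x).map φ = skewMatrix (φ ∘ x) := by
  ext i j
  simp only [skewMatrix, Matrix.map_apply, Function.comp_apply]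
  split_ifs <;> simp

theorem comp_signedPfaffian {F : Type*} [FunLike F S T] [RingHomClass F S T] (φ : F)
    (x : Pair → S) : φ ∘ signedPfaffian x = signedPfaffian (φ ∘ x) := by
  ext h
  simp only [signedPfaffian, ← skewMatrix_map, Function.comp_apply, pfaffianFour]
  simp

theorem replicateRow_signedPfaffian_map {F : Type*} [FunLike F S T] [RingHomClass F S T] (φ : F)
    (x : Pair → S) : (replicateRow (Fin 1) (signedPfaffian x)).map φ =
      replicateRow (Fin 1) (signedPfaffian (φ ∘ x)) :=
  congrArg (replicateRow (Fin 1)) (comp_signedPfaffian φ x)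

theorem replicateCol_signedPfaffian_map {F : Type*} [FunLike F S T] [RingHomClass F S T] (φ : F)
    (x : Pair → S) : (replicateCol (Fin 1) (signedPfaffian x)).map φ =
      replicateCol (Fin 1) (signedPfaffian (φ ∘ x)) :=
  congrArg (replicateCol (Fin 1)) (comp_signedPfaffian φ x)

theorem isWeightedHomogeneous_skewMatrix {σ N : Type*} [AddCommMonoid N] {w : σ → N}
    {x : Pair → MvPolynomial σ S} {d : N} (hx : ∀ p, IsWeightedHomogeneous w (x p) d)
    (i j : Fin 5) : IsWeightedHomogeneous w (skewMatrix x i j) d := by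
  unfold skewMatrix
  split_ifs
  · exact hx _
  · exact (hx _).neg
  · exact isWeightedHomogeneous_zero S w d

theorem isWeightedHomogeneous_signedPfaffian {σ N : Type*} [AddCommMonoid N] {w : σ → N}
    {x : Pair → MvPolynomial σ S} {d : N} (hx : ∀ p, IsWeightedHomogeneous w (x p) d)
    (h : Fin 5) : IsWeightedHomogeneous w (signedPfaffian x h) (d + d) := by
  have hmul : ∀ i j k l, IsWeightedHomogeneous w (skewMatrix x i j * skewMatrix x k l) (d + d) :=
    fun i j k l =>
      (isWeightedHomogeneous_skewMatrix hx i j).mul (isWeightedHomogeneous_skewMatrix hx k l)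
  have hsign : IsWeightedHomogeneous w ((-1 : MvPolynomial σ S) ^ (h : ℕ)) 0 := by
    simpa using (isWeightedHomogeneous_one S w).neg.pow (h : ℕ)
  rw [signedPfaffian, ← zero_add (d + d)]
  exact hsign.mul (((hmul ..).sub (hmul ..)).add (hmul ..))

end Pfaffians

section Pentagon

variable {R : Type*} [CommRing R]

theorem exists_eq_X_mul_of_add_eq_zero {σ : Type*} {i j : σ} (hij : i ≠ j)
    {f g : MvPolynomial σ R} (h : X i * f + X j * g = 0) :
    ∃ c, f = X j * c ∧ g = -(X i * c) := by
  have hf : f ∈ Ideal.span (X '' {j}) := by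
    refine mem_span_X_image_of_X_mul_mem (y := i) hij ?_
    rw [Set.image_singleton, eq_neg_of_add_eq_zero_left h, ← mul_neg]
    exact Ideal.mul_mem_right _ _ (Ideal.mem_span_singleton_self _)
  rw [Set.image_singleton] at hf
  obtain ⟨c, rfl⟩ := Ideal.mem_span_singleton.1 hf
  refine ⟨c, rfl, (X_mul_cancel_left_iff (i := j)).1 ?_⟩
  linear_combination h

theorem exists_eq_X_mul_add_X_mul {σ : Type*} {i j k : σ} (hki : k ≠ i) (hkj : k ≠ j)
    {c f g : MvPolynomial σ R} (h : X k * c = X i * f + X j * g) :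
    ∃ a b, c = X i * a + X j * b := by
  have hc : c ∈ Ideal.span (X '' {i, j}) := by
    refine mem_span_X_image_of_X_mul_mem (y := k) (by simp [hki, hkj]) ?_
    rw [Set.image_pair, h, Ideal.mem_span_pair]
    exact ⟨f, g, by ring⟩
  rw [Set.image_pair, Ideal.mem_span_pair] at hc
  obtain ⟨a, b, rfl⟩ := hc
  exact ⟨a, b, by ring⟩

/-- The sides `03`, `32`, `21`, `14`, `40` of a pentagon with vertices `0, 3, 2, 1, 4`. -/
def side : Fin 5 → Pair := ![pair 0 3, pair 0 4, pair 1 2, pair 1 4, pair 2 3]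

theorem side_injective : Function.Injective side := by decide

variable (R) in
/-- The specialization of the generic skew-symmetric matrix that kills the entries belonging to the
diagonals of the pentagon. -/
def pentagonPoint : Pair → MvPolynomial (Fin 5) R :=
  fun p => killCompl side_injective (X p)

theorem pentagonPoint_side (k : Fin 5) : pentagonPoint R (side k) = X k :=
  killCompl_X side_injective k

theorem pentagonPoint_diagonal {p : Pair} (hp : ∀ k, side k ≠ p) : pentagonPoint R p = 0 :=
  killCompl_X_of_notMem_range side_injective fun ⟨k, hk⟩ => hp k hk

theorem pentagonPoint_apply :
    pentagonPoint R (pair 0 1) = 0 ∧ pentagonPoint R (pair 0 2) = 0 ∧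
    pentagonPoint R (pair 0 3) = X 0 ∧ pentagonPoint R (pair 0 4) = X 1 ∧
    pentagonPoint R (pair 1 2) = X 2 ∧ pentagonPoint R (pair 1 3) = 0 ∧
    pentagonPoint R (pair 1 4) = X 3 ∧ pentagonPoint R (pair 2 3) = X 4 ∧
    pentagonPoint R (pair 2 4) = 0 ∧ pentagonPoint R (pair 3 4) = 0 :=
  ⟨pentagonPoint_diagonal (by decide), pentagonPoint_diagonal (by decide), pentagonPoint_side 0,
    pentagonPoint_side 1, pentagonPoint_side 2, pentagonPoint_diagonal (by decide),
    pentagonPoint_side 3, pentagonPoint_side 4, pentagonPoint_diagonal (by decide),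
    pentagonPoint_diagonal (by decide)⟩

theorem skewMatrix_pentagonPoint : skewMatrix (pentagonPoint R) =
    !![0, 0, 0, X 0, X 1;
      0, 0, X 2, 0, X 3;
      0, -X 2, 0, X 4, 0;
      -X 0, 0, -X 4, 0, 0;
      -X 1, -X 3, 0, 0, 0] := by
  simp only [skewMatrix_eq, pentagonPoint_apply, neg_zero]

theorem signedPfaffian_pentagonPoint : signedPfaffian (pentagonPoint R) =
    ![X 3 * X 4, -(X 1 * X 4), -(X 0 * X 3), -(X 1 * X 2), X 0 * X 2] := by
  simp [signedPfaffian_eq, pentagonPoint_apply]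

theorem exactModulo_replicateCol_pentagonPoint :
    ExactModulo ⊥ (replicateCol (Fin 1) (signedPfaffian (pentagonPoint R)))
      (skewMatrix (pentagonPoint R)) := by
  intro u hu
  rw [skewMatrix_pentagonPoint] at hu
  have e0 : X 0 * u 3 + X 1 * u 4 = 0 := by
    simpa [mulVec, dotProduct, Fin.sum_univ_five] using hu 0
  have e1 : X 2 * u 2 + X 3 * u 4 = 0 := by
    simpa [mulVec, dotProduct, Fin.sum_univ_five] using hu 1
  have e2 : X 2 * -u 1 + X 4 * u 3 = 0 := by
    simpa [mulVec, dotProduct, Fin.sum_univ_five] using hu 2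
  have e3 : X 0 * -u 0 + X 4 * -u 2 = 0 := by
    simpa [mulVec, dotProduct, Fin.sum_univ_five] using hu 3
  obtain ⟨a, h3, h4⟩ := exists_eq_X_mul_of_add_eq_zero (by decide) e0
  obtain ⟨b, h2, h4'⟩ := exists_eq_X_mul_of_add_eq_zero (by decide) e1
  obtain ⟨c, rfl, hb⟩ := exists_eq_X_mul_of_add_eq_zero (i := 0) (j := 2) (by decide)
    (f := a) (g := -b) (by linear_combination h4 - h4')
  have h1 : u 1 = X 1 * X 4 * c := (X_mul_cancel_left_iff (i := 2)).1 <| by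
    linear_combination X 4 * h3 - e2
  have h0 : u 0 = -(X 3 * X 4 * c) := (X_mul_cancel_left_iff (i := 0)).1 <| by
    linear_combination -e3 - X 4 * h2 + X 4 * X 3 * hb
  refine ⟨fun _ => -c, fun i => ?_⟩
  rw [signedPfaffian_pentagonPoint, Ideal.mem_bot]
  fin_cases i <;> simp only [mulVec, dotProduct, replicateCol_apply, Fin.sum_univ_one,
    Fin.reduceFinMk, Fin.zero_eta, Fin.mk_one, cons_val]
  · linear_combination h0
  · linear_combination h1
  · linear_combination h2 - X 3 * hb
  · linear_combination h3
  · linear_combination h4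

theorem exists_mulVec_eq_of_pentagon_relation {u : Fin 5 → MvPolynomial (Fin 5) R}
    (e : X 3 * X 4 * u 0 - X 1 * X 4 * u 1 - X 0 * X 3 * u 2 - X 1 * X 2 * u 3 +
      X 0 * X 2 * u 4 = 0) : ∃ w, u = skewMatrix (pentagonPoint R) *ᵥ w := by
  have e' : X 3 * (X 4 * u 0) = X 0 * (X 3 * u 2 - X 2 * u 4) + X 1 * (X 4 * u 1 + X 2 * u 3) := by
    linear_combination e
  obtain ⟨a', b', h⟩ := exists_eq_X_mul_add_X_mul (by decide) (by decide) e'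
  obtain ⟨a, b, h0⟩ := exists_eq_X_mul_add_X_mul (by decide) (by decide) h
  have h' : X 1 * (X 4 * (u 1 - X 3 * b) + X 2 * u 3) +
      X 0 * (X 3 * (u 2 - X 4 * a) - X 2 * u 4) = 0 := by
    linear_combination X 3 * X 4 * h0 - e
  obtain ⟨c, h13, h24⟩ := exists_eq_X_mul_of_add_eq_zero (by decide) h'
  obtain ⟨c₁, c₂, rfl⟩ := exists_eq_X_mul_add_X_mul (by decide) (by decide) h13.symm
  have h13' : X 4 * (u 1 - X 3 * b - X 0 * c₁) + X 2 * (u 3 - X 0 * c₂) = 0 := by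
    linear_combination h13
  obtain ⟨d, h1, h3⟩ := exists_eq_X_mul_of_add_eq_zero (by decide) h13'
  have h24' : X 1 * (X 4 * c₁) = X 2 * (u 4 - X 1 * c₂) + X 3 * -(u 2 - X 4 * a) := by
    linear_combination h24
  obtain ⟨k', l', hk⟩ := exists_eq_X_mul_add_X_mul (by decide) (by decide) h24'
  obtain ⟨k, l, rfl⟩ := exists_eq_X_mul_add_X_mul (by decide) (by decide) hk
  have h24'' : X 3 * (u 2 - X 4 * a + X 1 * X 4 * l) +
      X 2 * -(u 4 - X 1 * c₂ - X 1 * X 4 * k) = 0 := by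
    linear_combination h24
  obtain ⟨m, h2, h4⟩ := exists_eq_X_mul_of_add_eq_zero (by decide) h24''
  refine ⟨![-(c₂ + X 4 * k), -m, d + X 0 * k, a - X 1 * l, b + X 0 * l], ?_⟩
  rw [skewMatrix_pentagonPoint]
  ext1 i
  fin_cases i <;> simp only [mulVec, dotProduct, Fin.sum_univ_five, Fin.reduceFinMk,
    Fin.zero_eta, Fin.mk_one, of_apply, cons_val', cons_val]
  · linear_combination h0
  · linear_combination h1
  · linear_combination h2
  · linear_combination h3
  · linear_combination -h4

theorem exactModulo_skewMatrix_pentagonPoint :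
    ExactModulo ⊥ (skewMatrix (pentagonPoint R))
      (replicateRow (Fin 1) (signedPfaffian (pentagonPoint R))) := by
  intro u hu
  have h := hu 0
  rw [signedPfaffian_pentagonPoint, replicateRow_mulVec_apply, Ideal.mem_bot,
    Fin.sum_univ_five] at h
  simp only [cons_val] at h
  obtain ⟨w, rfl⟩ := exists_mulVec_eq_of_pentagon_relation (u := u) (by linear_combination h)
  exact ⟨w, by simp⟩

end Pentagon

section GenericExactness

variable {R : Type*} [CommRing R]

theorem exactModulo_replicateCol_X {T : Set Pair} (hT : T ⊆ (Set.range side)ᶜ) :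
    ExactModulo (Ideal.span (X '' T : Set (MvPolynomial Pair R)))
      (replicateCol (Fin 1) (signedPfaffian X)) (skewMatrix X) := by
  refine .of_map_killCompl side_injective hT
    (fun i _ => isWeightedHomogeneous_signedPfaffian (isHomogeneous_X R) i)
    (skewMatrix_mul_replicateCol_signedPfaffian X) ?_
  rw [skewMatrix_map, replicateCol_signedPfaffian_map]
  exact exactModulo_replicateCol_pentagonPoint

theorem exactModulo_skewMatrix_X {T : Set Pair} (hT : T ⊆ (Set.range side)ᶜ) :
    ExactModulo (Ideal.span (X '' T : Set (MvPolynomial Pair R))) (skewMatrix X)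
      (replicateRow (Fin 1) (signedPfaffian X)) := by
  refine .of_map_killCompl side_injective hT
    (isWeightedHomogeneous_skewMatrix (isHomogeneous_X R))
    (replicateRow_signedPfaffian_mul_skewMatrix X) ?_
  rw [skewMatrix_map, replicateRow_signedPfaffian_map]
  exact exactModulo_skewMatrix_pentagonPoint

end GenericExactness

section Elimination

variable {R σ : Type*} [CommRing R]

theorem exists_X_pow_mul_sub_mem {I : Ideal (MvPolynomial σ R)} {x : σ} {s : Set σ} (hx : x ∈ s)
    (h : ∀ y ∉ s, ∃ g ∈ supported R s, X x * X y - g ∈ I) (P : MvPolynomial σ R) :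
    ∃ N : ℕ, ∃ g ∈ supported R s, X x ^ N * P - g ∈ I := by
  have hX : ∀ {y}, y ∈ s → (X y : MvPolynomial σ R) ∈ supported R s :=
    fun hy => Algebra.subset_adjoin ⟨_, hy, rfl⟩
  have h' : ∀ y, ∃ g ∈ supported R s, X x * X y - g ∈ I := fun y => by
    by_cases hy : y ∈ s
    · exact ⟨X x * X y, mul_mem (hX hx) (hX hy), by simp⟩
    · exact h y hy
  induction P using MvPolynomial.induction_on with
  | C a => exact ⟨0, C a, (supported R s).algebraMap_mem a, by simp⟩
  | add p q hp hq =>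
    obtain ⟨M, f, hf, hpf⟩ := hp
    obtain ⟨N, g, hg, hqg⟩ := hq
    refine ⟨M + N, X x ^ N * f + X x ^ M * g, add_mem (mul_mem (pow_mem (hX hx) _) hf)
      (mul_mem (pow_mem (hX hx) _) hg), ?_⟩
    convert add_mem (I.mul_mem_left (X x ^ N) hpf) (I.mul_mem_left (X x ^ M) hqg) using 1
    ring
  | mul_X p y hp =>
    obtain ⟨M, f, hf, hpf⟩ := hp
    obtain ⟨g, hg, hyg⟩ := h' y
    refine ⟨M + 1, f * g, mul_mem hf hg, ?_⟩
    convert add_mem (I.mul_mem_left (X x * X y) hpf) (I.mul_mem_left f hyg) using 1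
    ring

theorem eval_eq_of_mem_supported {s : Set σ} {g : MvPolynomial σ R} (hg : g ∈ supported R s)
    {z z' : σ → R} (h : ∀ y ∈ s, z' y = z y) : eval z' g = eval z g :=
  eval₂Hom_congr' rfl (fun y hy _ => h y (mem_supported.1 hg hy)) rfl

theorem mem_ideal_of_vanishing [IsDomain R] [Infinite R] {I : Ideal (MvPolynomial σ R)} {x : σ}
    {s : Set σ} (hx : x ∈ s) (h : ∀ y ∉ s, ∃ g ∈ supported R s, X x * X y - g ∈ I)
    (hreg : ∀ f, X x * f ∈ I → f ∈ I) {P : MvPolynomial σ R}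
    (hP : ∀ z : σ → R, z x ≠ 0 →
      ∃ z' : σ → R, (∀ y ∈ s, z' y = z y) ∧ (∀ f ∈ I, eval z' f = 0) ∧ eval z' P = 0) :
    P ∈ I := by
  obtain ⟨N, g, hg, hPg⟩ := exists_X_pow_mul_sub_mem hx h P
  have hg0 : X x * g = 0 := by
    refine MvPolynomial.funext fun z => ?_
    by_cases hz : z x = 0
    · simp [hz]
    · obtain ⟨z', hz', hI, hPz'⟩ := hP z hz
      have hgz := hI _ hPg
      rw [map_sub, map_mul, hPz', mul_zero, zero_sub, neg_eq_zero,
        eval_eq_of_mem_supported hg hz'] at hgz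
      simp [hgz]
  rw [(mul_eq_zero.1 hg0).resolve_left (X_ne_zero x), sub_zero] at hPg
  exact mem_of_pow_mul_mem hreg hPg

theorem exists_clear_denominators {τ : Type*} (x : σ) (q : τ → MvPolynomial σ R)
    (f : MvPolynomial τ R) :
    ∃ (N : ℕ) (G : MvPolynomial σ R), ∀ (z : σ → R) (c : τ → R),
      (∀ t, z x * c t = eval z (q t)) → z x ^ N * eval c f = eval z G := by
  induction f using MvPolynomial.induction_on with
  | C a => exact ⟨0, C a, fun z c _ => by simp⟩
  | add p q hp hq =>
    obtain ⟨M, F, hF⟩ := hp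
    obtain ⟨N, G, hG⟩ := hq
    refine ⟨M + N, X x ^ N * F + X x ^ M * G, fun z c h => ?_⟩
    simp only [map_add, map_mul, map_pow, eval_X, ← hF z c h, ← hG z c h]
    ring
  | mul_X p t hp =>
    obtain ⟨M, F, hF⟩ := hp
    refine ⟨M + 1, F * q t, fun z c h => ?_⟩
    simp only [map_mul, eval_X, ← hF z c h, ← h t]
    ring

end Elimination

section PluckerIdeal

variable {R : Type*} [CommRing R]

variable (R) in
/-- The ideal of the section of the cone over the Grassmannian `G(2,5)` by the coordinate subspace
on which the coordinates in `T` vanish. -/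
def sectionIdeal (T : Set Pair) : Ideal (MvPolynomial Pair R) :=
  Ideal.span (Set.range (signedPfaffian X)) ⊔ Ideal.span (X '' T)

theorem sectionIdeal_empty : sectionIdeal R ∅ = Ideal.span (Set.range (signedPfaffian X)) := by
  rw [sectionIdeal, Set.image_empty, Ideal.span_empty, sup_bot_eq]

theorem sectionIdeal_singleton (p : Pair) :
    sectionIdeal R {p} = sectionIdeal R ∅ ⊔ Ideal.span {X p} := by
  rw [sectionIdeal_empty, sectionIdeal, Set.image_singleton]

theorem signedPfaffian_mem_sectionIdeal (T : Set Pair) (h : Fin 5) :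
    signedPfaffian X h ∈ sectionIdeal R T :=
  Ideal.mem_sup_left (Ideal.subset_span ⟨h, rfl⟩)

theorem plucker_relation_mem_sectionIdeal (T : Set Pair) {i j k l : Fin 5} (hij : i < j)
    (hjk : j < k) (hkl : k < l) :
    X (pair i j hij) * X (pair k l hkl) -
      X (pair i k (hij.trans hjk)) * X (pair j l (hjk.trans hkl)) +
      X (pair i l (hij.trans (hjk.trans hkl))) * X (pair j k hjk) ∈ sectionIdeal R T := by
  obtain ⟨h, ⟨⟩⟩ : ∃ h : Fin 5, (i, j, k, l) =
      (h.succAbove 0, h.succAbove 1, h.succAbove 2, h.succAbove 3) := by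
    revert i j k l
    decide
  have hmem := (sectionIdeal R T).mul_mem_left ((-1) ^ (h : ℕ))
    (signedPfaffian_mem_sectionIdeal T h)
  rw [signedPfaffian, ← mul_assoc, ← mul_pow, neg_one_mul, neg_neg, one_pow, one_mul] at hmem
  simpa only [pfaffianFour, submatrix_apply, skewMatrix, dif_pos hij, dif_pos hjk, dif_pos hkl,
    dif_pos (hij.trans hjk), dif_pos (hjk.trans hkl), dif_pos (hij.trans (hjk.trans hkl))]
    using hmem

theorem X_mem_sectionIdeal {T : Set Pair} {p : Pair} (hp : p ∈ T) : X p ∈ sectionIdeal R T :=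
  Ideal.mem_sup_right (Ideal.subset_span ⟨p, hp, rfl⟩)

theorem mem_sectionIdeal_of_X_mul_mem {T : Set Pair} {p : Pair}
    (hT : insert p T ⊆ (Set.range side)ᶜ) (hp : p ∉ T) {f : MvPolynomial Pair R}
    (hf : X p * f ∈ sectionIdeal R T) : f ∈ sectionIdeal R T := by
  have hexact := exactModulo_skewMatrix_X (R := R) hT
  rw [Set.image_insert_eq, Ideal.span_insert, sup_comm] at hexact
  exact hexact.mem_span_sup_of_mul_mem (replicateRow_signedPfaffian_mul_skewMatrix X)
    (fun g => mem_span_X_image_of_X_mul_mem hp) hf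

/-- The vector of the brackets of five vectors in the plane. -/
def bracketPoint (v : Fin 5 → Fin 2 → R) : Pair → R :=
  fun p => v p.1.1 0 * v p.1.2 1 - v p.1.1 1 * v p.1.2 0

theorem skewMatrix_bracketPoint (v : Fin 5 → Fin 2 → R) (i j : Fin 5) :
    skewMatrix (bracketPoint v) i j = v i 0 * v j 1 - v i 1 * v j 0 := by
  rcases lt_trichotomy i j with h | rfl | h
  · simp [skewMatrix, bracketPoint, h]
  · simp [skewMatrix, mul_comm]
  · rw [skewMatrix, dif_neg h.not_gt, dif_pos h, bracketPoint]
    ring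

theorem bracketPoint_single (p q : Pair) :
    bracketPoint (fun i b => if i = ![p.1.1, p.1.2] b then (1 : R) else 0) q =
      if q = p then 1 else 0 := by
  obtain ⟨⟨i, j⟩, hij⟩ := p
  obtain ⟨⟨k, l⟩, hkl⟩ := q
  simp only [bracketPoint, Subtype.mk.injEq, Prod.mk.injEq, cons_val_zero, cons_val_one]
  grind

theorem signedPfaffian_bracketPoint (v : Fin 5 → Fin 2 → R) :
    signedPfaffian (bracketPoint v) = 0 := by
  rw [signedPfaffian_eq]
  ext h
  fin_cases h <;> simp only [bracketPoint, Fin.reduceFinMk, Fin.zero_eta, Fin.mk_one, cons_val,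
    Pi.zero_apply] <;> ring

theorem eval_skewMatrix_X (z : Pair → R) (i j : Fin 5) :
    eval z (skewMatrix X i j) = skewMatrix z i j := by
  rw [← Matrix.map_apply (f := eval z), skewMatrix_map]
  exact congrArg (skewMatrix · i j) (funext fun p => eval_X p)

theorem eval_signedPfaffian_X (z : Pair → R) (h : Fin 5) :
    eval z (signedPfaffian X h) = signedPfaffian z h := by
  rw [← Function.comp_apply (f := eval z), comp_signedPfaffian]
  exact congrArg (signedPfaffian · h) (funext fun p => eval_X p)

theorem eval_bracketPoint_eq_zero {T : Set Pair} {v : Fin 5 → Fin 2 → R}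
    (hv : ∀ p ∈ T, bracketPoint v p = 0) {f : MvPolynomial Pair R} (hf : f ∈ sectionIdeal R T) :
    eval (bracketPoint v) f = 0 := by
  have hle : sectionIdeal R T ≤ RingHom.ker (eval (bracketPoint v)) := by
    refine sup_le (Ideal.span_le.2 ?_) (Ideal.span_le.2 ?_)
    · rintro _ ⟨h, rfl⟩
      rw [SetLike.mem_coe, RingHom.mem_ker, eval_signedPfaffian_X, signedPfaffian_bracketPoint,
        Pi.zero_apply]
    · rintro _ ⟨p, hp, rfl⟩
      rw [SetLike.mem_coe, RingHom.mem_ker, eval_X, hv p hp]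
  exact hle hf

theorem X_mul_X_mem_supported {σ : Type*} {s : Set σ} {i j : σ} (hi : i ∈ s) (hj : j ∈ s) :
    X i * X j ∈ supported R s :=
  mul_mem (Algebra.subset_adjoin ⟨i, hi, rfl⟩) (Algebra.subset_adjoin ⟨j, hj, rfl⟩)

/-- Coordinates of the cone over `G(2,5)` that determine the others where `X (pair 0 1) ≠ 0`. -/
def firstChart : Set Pair := {p | p.1.1 ≤ 1}

/-- Coordinates of the section of the cone over `G(2,5)` by `X (pair 0 1) = 0` that determine the
others where `X (pair 0 2) ≠ 0`. -/
def secondChart : Set Pair := {p | p ≠ pair 0 1 ∧ (p.1.1 = 0 ∨ p.1.1 = 2 ∨ p.1.2 = 2)}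

theorem exists_mul_sub_mem_of_notMem_firstChart {p : Pair} (hp : p ∉ firstChart) :
    ∃ g ∈ supported R firstChart, X (pair 0 1) * X p - g ∈ sectionIdeal R ∅ := by
  obtain ⟨⟨k, l⟩, hkl⟩ := p
  have h01 : (0 : Fin 5) < 1 := by decide
  have hk : 1 < k := not_le.1 hp
  have hchart : ∀ {i j : Fin 5} {h : i < j}, i ≤ 1 → pair i j h ∈ firstChart := id
  refine ⟨X (pair 0 k (h01.trans hk)) * X (pair 1 l (hk.trans hkl)) -
      X (pair 0 l (h01.trans (hk.trans hkl))) * X (pair 1 k hk),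
    sub_mem (X_mul_X_mem_supported (hchart h01.le) (hchart le_rfl))
      (X_mul_X_mem_supported (hchart h01.le) (hchart le_rfl)), ?_⟩
  convert plucker_relation_mem_sectionIdeal ∅ h01 hk hkl using 1
  ring

theorem exists_mul_sub_mem_of_notMem_secondChart {p : Pair} (hp : p ∉ secondChart) :
    ∃ g ∈ supported R secondChart, X (pair 0 2) * X p - g ∈ sectionIdeal R {pair 0 1} := by
  have hX : X (pair 0 1) ∈ sectionIdeal R {pair 0 1} := X_mem_sectionIdeal rfl
  have h2 : (0 : Fin 5) < 1 ∧ (1 : Fin 5) < 2 := by decide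
  have hp' : p = pair 0 1 ∨ (∃ l hl, p = pair 1 l (h2.2.trans hl)) ∨ p = pair 3 4 := by
    change ¬(p ≠ pair 0 1 ∧ (p.1.1 = 0 ∨ p.1.1 = 2 ∨ p.1.2 = 2)) at hp
    revert h2 p
    decide
  rcases hp' with rfl | ⟨l, hl, rfl⟩ | rfl
  · exact ⟨0, zero_mem _, by simpa using Ideal.mul_mem_left _ (X (pair 0 2)) hX⟩
  · refine ⟨X (pair 0 l (h2.1.trans (h2.2.trans hl))) * X (pair 1 2 h2.2), X_mul_X_mem_supported
      (by simp [secondChart, (h2.2.trans hl).ne']) (by simp [secondChart]), ?_⟩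
    convert sub_mem (Ideal.mul_mem_left _ (X (pair 2 l hl)) hX)
      (plucker_relation_mem_sectionIdeal _ h2.1 h2.2 hl) using 1
    ring
  · refine ⟨X (pair 0 3) * X (pair 2 4) - X (pair 0 4) * X (pair 2 3),
      sub_mem (X_mul_X_mem_supported (by simp [secondChart]) (by simp [secondChart]))
        (X_mul_X_mem_supported (by simp [secondChart]) (by simp [secondChart])), ?_⟩
    convert plucker_relation_mem_sectionIdeal (R := R) {pair 0 1}
      (h2.1.trans h2.2) (by decide : (2 : Fin 5) < 3) (by decide : (3 : Fin 5) < 4) using 1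
    ring

section Vanishing

variable {K : Type*} [Field K] [Infinite K] {P : MvPolynomial Pair K}

theorem mem_sectionIdeal_empty_of_vanishing
    (hP : ∀ v : Fin 5 → Fin 2 → K, eval (bracketPoint v) P = 0) : P ∈ sectionIdeal K ∅ := by
  refine mem_ideal_of_vanishing (x := pair 0 1) (s := firstChart) (Fin.zero_le 1)
    (fun p => exists_mul_sub_mem_of_notMem_firstChart)
    (fun f => mem_sectionIdeal_of_X_mul_mem (by simp [side, pair]) (Set.notMem_empty _))
    fun z hz => ?_
  let v : Fin 5 → Fin 2 → K := ![![1, 0], ![0, z (pair 0 1)],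
    ![-z (pair 1 2) / z (pair 0 1), z (pair 0 2)], ![-z (pair 1 3) / z (pair 0 1), z (pair 0 3)],
    ![-z (pair 1 4) / z (pair 0 1), z (pair 0 4)]]
  refine ⟨bracketPoint v, ?_, fun f => eval_bracketPoint_eq_zero fun p hp => hp.elim, hP v⟩
  refine forall_pair ?_ ?_ ?_ ?_ ?_ ?_ ?_ ?_ ?_ ?_ <;>
    simp [firstChart, bracketPoint, v, neg_div, mul_div_cancel₀, hz]

theorem mem_sectionIdeal_singleton_of_vanishing
    (hP : ∀ v : Fin 5 → Fin 2 → K, bracketPoint v (pair 0 1) = 0 → eval (bracketPoint v) P = 0) :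
    P ∈ sectionIdeal K {pair 0 1} := by
  refine mem_ideal_of_vanishing (x := pair 0 2) (s := secondChart) (by simp [secondChart])
    (fun p => exists_mul_sub_mem_of_notMem_secondChart)
    (fun f => mem_sectionIdeal_of_X_mul_mem ?_ (by simp)) fun z hz => ?_
  · simp [side, pair, Set.insert_subset_iff]
  let v : Fin 5 → Fin 2 → K := ![![1, 0], ![z (pair 1 2) / z (pair 0 2), 0],
    ![0, z (pair 0 2)], ![-z (pair 2 3) / z (pair 0 2), z (pair 0 3)],
    ![-z (pair 2 4) / z (pair 0 2), z (pair 0 4)]]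
  have hv : bracketPoint v (pair 0 1) = 0 := by simp [bracketPoint, v]
  refine ⟨bracketPoint v, ?_, fun f => eval_bracketPoint_eq_zero fun p hp => hp ▸ hv, hP v hv⟩
  refine forall_pair ?_ ?_ ?_ ?_ ?_ ?_ ?_ ?_ ?_ ?_ <;>
    simp [secondChart, bracketPoint, v, neg_div, mul_div_cancel₀, hz]

end Vanishing

end PluckerIdeal

section FundamentalTheorems

variable {K : Type u} [Field K]

theorem eval_brackets (v : Fin 5 → Fin 2 → K) (p : Pair) :
    eval (fun q => v q.1 q.2) (brackets K p : MvPolynomial (Fin 5 × Fin 2) K) =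
      bracketPoint v p := by
  simp [brackets, bracket, bracketPoint]

theorem eval_aeval_brackets (v : Fin 5 → Fin 2 → K) (G : MvPolynomial Pair K) :
    eval (fun q => v q.1 q.2) (aeval (brackets K) G : MvPolynomial (Fin 5 × Fin 2) K) =
      eval (bracketPoint v) G := by
  have h : (aeval fun q : Fin 5 × Fin 2 => v q.1 q.2).comp
      ((invariants K 5).val.comp (aeval (brackets K))) = aeval (bracketPoint v) := by
    refine MvPolynomial.algHom_ext fun p => ?_
    simpa using eval_brackets v p
  exact DFunLike.congr_fun h G

theorem invariants_ext [Infinite K] {n : ℕ} {f g : invariants K n}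
    (h : ∀ v : Fin n → Fin 2 → K, eval (fun q => v q.1 q.2) (f : MvPolynomial (Fin n × Fin 2) K) =
      eval (fun q => v q.1 q.2) (g : MvPolynomial (Fin n × Fin 2) K)) : f = g :=
  Subtype.ext (MvPolynomial.funext fun z => h fun i b => z (i, b))

theorem aeval_brackets_eq_zero_iff [Infinite K] {G : MvPolynomial Pair K} :
    aeval (brackets K) G = 0 ↔ G ∈ sectionIdeal K ∅ := by
  constructor
  · intro hG
    refine mem_sectionIdeal_empty_of_vanishing fun v => ?_
    rw [← eval_aeval_brackets, hG, ZeroMemClass.coe_zero, map_zero]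
  · intro hG
    refine invariants_ext fun v => ?_
    rw [eval_aeval_brackets, eval_bracketPoint_eq_zero (fun p hp => hp.elim) hG,
      ZeroMemClass.coe_zero, map_zero]

theorem exists_specialLinear_mulVec_eq {v : Fin 5 → Fin 2 → K}
    (hv : bracketPoint v (pair 0 1) ≠ 0) :
    ∃ g : Matrix.SpecialLinearGroup (Fin 2) K, ∀ i,
      (g : Matrix (Fin 2) (Fin 2) K) *ᵥ v i =
        ![skewMatrix (bracketPoint v) i 1 / bracketPoint v (pair 0 1),
          skewMatrix (bracketPoint v) 0 i] := by
  set b := bracketPoint v (pair 0 1) with hb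
  refine ⟨⟨!![v 1 1 / b, -v 1 0 / b; -v 0 1, v 0 0], ?_⟩, fun i => ?_⟩
  · rw [det_fin_two_of]
    field_simp
    rw [hb, bracketPoint]
    ring
  · rw [skewMatrix_bracketPoint, skewMatrix_bracketPoint]
    ext j
    fin_cases j <;> simp [mulVec, dotProduct, Fin.sum_univ_two] <;> ring

theorem exists_bracket_pow_mul_eq [Infinite K] (f : invariants K 5) :
    ∃ (N : ℕ) (G : MvPolynomial Pair K), brackets K (pair 0 1) ^ N * f = aeval (brackets K) G := by
  obtain ⟨N, G, hG⟩ := exists_clear_denominators (pair 0 1)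
    (fun t : Fin 5 × Fin 2 => ![skewMatrix X t.1 1, X (pair 0 1) * skewMatrix X 0 t.1] t.2)
    (f : MvPolynomial (Fin 5 × Fin 2) K)
  refine ⟨N + 1, X (pair 0 1) * G, invariants_ext fun v => ?_⟩
  rw [eval_aeval_brackets, map_mul, eval_X, MulMemClass.coe_mul, SubmonoidClass.coe_pow, map_mul,
    map_pow, eval_brackets]
  by_cases hv : bracketPoint v (pair 0 1) = 0
  · simp [hv]
  · obtain ⟨g, hg⟩ := exists_specialLinear_mulVec_eq hv
    have hclear := hG (bracketPoint v)
      (fun q => ((g : Matrix (Fin 2) (Fin 2) K) *ᵥ v q.1) q.2) fun ⟨i, b⟩ => by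
        rw [hg]
        fin_cases b <;> simp [eval_skewMatrix_X, mul_div_cancel₀, hv]
    rw [← hclear, f.2 g v, pow_succ', mul_assoc]

theorem brackets_notMem_adjoin (p : Pair) :
    brackets K p ∉ Algebra.adjoin K (brackets K '' {p}ᶜ) := by
  intro hmem
  let evalAt (v : Fin 5 → Fin 2 → K) : invariants K 5 →ₐ[K] K :=
    (aeval fun q => v q.1 q.2).comp (invariants K 5).val
  have hevalAt : ∀ v q, evalAt v (brackets K q) = bracketPoint v q := eval_brackets
  let v : Fin 5 → Fin 2 → K := fun i b => if i = ![p.1.1, p.1.2] b then 1 else 0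
  have hle : Algebra.adjoin K (brackets K '' {p}ᶜ) ≤ AlgHom.equalizer (evalAt v) (evalAt 0) := by
    refine Algebra.adjoin_le ?_
    rintro _ ⟨q, hq, rfl⟩
    change evalAt v _ = evalAt 0 _
    rw [hevalAt, hevalAt, bracketPoint_single, if_neg (show q ≠ p from hq)]
    simp [bracketPoint]
  have heq : evalAt v (brackets K p) = evalAt 0 (brackets K p) := hle hmem
  rw [hevalAt, hevalAt, bracketPoint_single, if_pos rfl] at heq
  simp [bracketPoint] at heq

theorem brackets_ne_zero (p : Pair) : brackets K p ≠ 0 :=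
  fun h => brackets_notMem_adjoin p (h ▸ zero_mem _)

theorem aeval_brackets_surjective [Infinite K] :
    Function.Surjective (aeval (brackets K) : MvPolynomial Pair K →ₐ[K] invariants K 5) := by
  intro f
  obtain ⟨N, G, hG⟩ := exists_bracket_pow_mul_eq f
  induction N generalizing G with
  | zero => exact ⟨G, by rw [← hG, pow_zero, one_mul]⟩
  | succ N ih =>
    have hmem : G ∈ sectionIdeal K ∅ ⊔ Ideal.span {X (pair 0 1)} := by
      refine sectionIdeal_singleton (R := K) _ ▸
        mem_sectionIdeal_singleton_of_vanishing fun v hv => ?_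
      rw [← eval_aeval_brackets, ← hG, MulMemClass.coe_mul, map_mul, SubmonoidClass.coe_pow,
        map_pow, eval_brackets, hv, zero_pow N.succ_ne_zero, zero_mul]
    obtain ⟨g, hg, h, hh, rfl⟩ := Submodule.mem_sup.1 hmem
    obtain ⟨k, rfl⟩ := Ideal.mem_span_singleton.1 hh
    refine ih k (mul_left_cancel₀ (brackets_ne_zero (pair 0 1)) ?_)
    rw [← mul_assoc, ← pow_succ', hG, map_add, aeval_brackets_eq_zero_iff.2 hg, zero_add, map_mul,
      aeval_X]

theorem signedPfaffian_X_eq (h : Fin 5) : signedPfaffian X h = (-1) ^ (h : ℕ) * plucker K h :=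
  rfl

theorem plucker_eq (h : Fin 5) : plucker K h = (-1) ^ (h : ℕ) * signedPfaffian X h := by
  rw [signedPfaffian_X_eq, ← mul_assoc, ← mul_pow, neg_one_mul, neg_neg, one_pow, one_mul]

theorem sectionIdeal_empty_eq_span_plucker :
    sectionIdeal K ∅ = Ideal.span (Set.range (plucker K)) := by
  refine sectionIdeal_empty.trans (le_antisymm (Ideal.span_le.2 ?_) (Ideal.span_le.2 ?_))
  · rintro _ ⟨h, rfl⟩
    exact signedPfaffian_X_eq (K := K) h ▸ Ideal.mul_mem_left _ _ (Ideal.subset_span ⟨h, rfl⟩)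
  · rintro _ ⟨h, rfl⟩
    exact plucker_eq (K := K) h ▸ Ideal.mul_mem_left _ _ (Ideal.subset_span ⟨h, rfl⟩)

theorem ker_aeval_brackets [Infinite K] :
    RingHom.ker (aeval (brackets K) : MvPolynomial Pair K →ₐ[K] invariants K 5) =
      Ideal.span (Set.range (plucker K)) := by
  rw [← sectionIdeal_empty_eq_span_plucker]
  exact Ideal.ext fun G => aeval_brackets_eq_zero_iff

theorem plucker_notMem (h : Fin 5) : plucker K h ∉ Ideal.span (plucker K '' {h}ᶜ) := by
  intro hmem
  let z : Pair → K := fun p => if p.1.1 = h ∨ p.1.2 = h then 0 else 1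
  have heval : ∀ k, eval z (plucker K k) = (-1) ^ (k : ℕ) * signedPfaffian z k := fun k => by
    rw [plucker_eq, map_mul, eval_signedPfaffian_X, map_pow, map_neg, map_one]
  have hle : Ideal.span (plucker K '' {h}ᶜ) ≤ RingHom.ker (eval z) := by
    refine Ideal.span_le.2 ?_
    rintro _ ⟨k, hk, rfl⟩
    rw [SetLike.mem_coe, RingHom.mem_ker, heval, signedPfaffian_eq]
    fin_cases h <;> fin_cases k <;> simp [z] at hk ⊢
  have hzero : eval z (plucker K h) = 0 := hle hmem
  rw [heval, signedPfaffian_eq] at hzero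
  fin_cases h <;> simp [z] at hzero

theorem brackets_isHomogeneous (p : Pair) :
    (brackets K p : MvPolynomial (Fin 5 × Fin 2) K).IsHomogeneous 2 :=
  ((isHomogeneous_X K _).mul (isHomogeneous_X K _)).sub
    ((isHomogeneous_X K _).mul (isHomogeneous_X K _))

theorem isMinimalGenerators_brackets [Infinite K] :
    IsMinimalGenerators (brackets K) fun _ => 2 where
  homogeneous := brackets_isHomogeneous
  generates := by
    rw [Algebra.adjoin_range_eq_range_aeval, AlgHom.range_eq_top]
    exact aeval_brackets_surjective
  irredundant := brackets_notMem_adjoin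

end FundamentalTheorems

section MinimalGenerators

theorem isWeightedHomogeneous_aeval {R σ τ M : Type*} [CommSemiring R] [AddCommMonoid M]
    {w : σ → M} {w' : τ → M} {g : σ → MvPolynomial τ R}
    (hg : ∀ s, IsWeightedHomogeneous w' (g s) (w s)) {P : MvPolynomial σ R} {n : M}
    (hP : IsWeightedHomogeneous w P n) : IsWeightedHomogeneous w' (aeval g P) n := by
  rw [aeval_def, eval₂_eq]
  refine IsWeightedHomogeneous.sum _ _ _ fun m hm => ?_
  rw [MvPolynomial.algebraMap_eq]
  refine IsWeightedHomogeneous.C_mul ?_ _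
  rw [← hP (mem_support_iff.1 hm), Finsupp.weight_apply, Finsupp.sum]
  exact IsWeightedHomogeneous.prod _ _ _ fun s _ => (hg s).pow _

theorem isWeightedHomogeneous_coe_aeval {R σ τ M : Type*} [CommSemiring R] [AddCommMonoid M]
    {w : σ → M} {w' : τ → M} {A : Subalgebra R (MvPolynomial τ R)} {f : σ → A}
    (hf : ∀ s, IsWeightedHomogeneous w' (f s : MvPolynomial τ R) (w s)) {P : MvPolynomial σ R}
    {n : M} (hP : IsWeightedHomogeneous w P n) :
    IsWeightedHomogeneous w' (aeval f P : MvPolynomial τ R) n := by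
  have hcoe : (aeval f P : MvPolynomial τ R) = aeval (fun s => (f s : MvPolynomial τ R)) P :=
    comp_aeval_apply f A.val P
  rw [hcoe]
  exact isWeightedHomogeneous_aeval hf hP

theorem eq_single_of_weight_eq {σ : Type*} {deg : σ → ℕ} {e : ℕ} (he : e ≠ 0)
    (hdeg : ∀ s, e ≤ deg s) {m : σ →₀ ℕ} (hm : Finsupp.weight deg m = e) :
    ∃ s, deg s = e ∧ m = Finsupp.single s 1 := by
  obtain ⟨s, hs⟩ : ∃ s, m s ≠ 0 := by
    by_contra! h
    obtain rfl : m = 0 := Finsupp.ext h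
    exact he (by rw [← hm, map_zero])
  have hsum := Finsupp.weight_sub_single_add (w := deg) hs
  have hrest : m - Finsupp.single s 1 = 0 := by
    ext t
    by_contra ht
    have hle := Finsupp.le_weight_of_ne_zero' deg ht
    have := hdeg s
    have := hdeg t
    omega
  refine ⟨s, ?_, ?_⟩
  · rwa [hrest, map_zero, zero_add, hm] at hsum
  · rw [← Finsupp.sub_add_single_one_cancel hs, hrest, zero_add]

variable {K : Type u} [Field K] {τ σ κ : Type*} {A : Subalgebra K (MvPolynomial τ K)}
  {f : σ → A} {deg : σ → ℕ} {b : κ → A} {d : ℕ}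

namespace IsMinimalGenerators

theorem exists_aeval_eq (hf : IsMinimalGenerators f deg) (x : A) :
    ∃ P : MvPolynomial σ K, aeval f P = x := by
  have hx : x ∈ Algebra.adjoin K (Set.range f) := hf.generates ▸ Algebra.mem_top
  rwa [Algebra.adjoin_range_eq_range_aeval] at hx

theorem homogeneousComponent_aeval_mem (hf : IsMinimalGenerators f deg) {e : ℕ} (he : e ≠ 0)
    (hdeg : ∀ s, e ≤ deg s) (P : MvPolynomial σ K) :
    homogeneousComponent e (aeval f P : MvPolynomial τ K) ∈
      (Submodule.span K (f '' {s | deg s = e})).map A.val.toLinearMap := by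
  induction P using MvPolynomial.induction_on' with
  | add P Q hP hQ =>
    rw [map_add, AddMemClass.coe_add, map_add]
    exact add_mem hP hQ
  | monomial m c =>
    have hhom : (aeval f (monomial m c) : MvPolynomial τ K).IsHomogeneous (Finsupp.weight deg m) :=
      isWeightedHomogeneous_coe_aeval hf.homogeneous (isWeightedHomogeneous_monomial deg m c rfl)
    rw [homogeneousComponent_of_mem hhom]
    split_ifs with hm
    · obtain ⟨s, hs, rfl⟩ := eq_single_of_weight_eq he hdeg hm.symm
      refine Submodule.mem_map_of_mem ?_
      have hval : aeval f (monomial (Finsupp.single s 1) c) = c • f s := by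
        rw [aeval_monomial, Finsupp.prod_single_index (by exact pow_zero (f s)), pow_one,
          Algebra.smul_def]
      rw [hval]
      exact Submodule.smul_mem _ c (Submodule.subset_span ⟨s, hs, rfl⟩)
    · exact zero_mem _

theorem mem_span_of_isHomogeneous (hf : IsMinimalGenerators f deg) {e : ℕ} (he : e ≠ 0)
    (hdeg : ∀ s, e ≤ deg s) {x : A} (hx : (x : MvPolynomial τ K).IsHomogeneous e) :
    x ∈ Submodule.span K (f '' {s | deg s = e}) := by
  obtain ⟨P, rfl⟩ := hf.exists_aeval_eq x
  obtain ⟨y, hy, hyP⟩ := hf.homogeneousComponent_aeval_mem he hdeg P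
  rw [homogeneousComponent_eq_self hx] at hyP
  rwa [← show y = aeval f P from Subtype.ext hyP]

theorem deg_ne_zero (hf : IsMinimalGenerators f deg) (s : σ) : deg s ≠ 0 := by
  intro hs
  have hconst := (homogeneousSubmodule_zero (R := K) (σ := τ)).le (hs ▸ hf.homogeneous s)
  obtain ⟨c, hc⟩ := Submodule.mem_one.1 hconst
  refine hf.irredundant s ?_
  rw [show f s = algebraMap K A c from Subtype.ext hc.symm]
  exact Subalgebra.algebraMap_mem _ c

theorem le_deg (hb : IsMinimalGenerators b fun _ => d) (hf : IsMinimalGenerators f deg) (s : σ) :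
    d ≤ deg s := by
  by_contra! hlt
  have hmem := hb.mem_span_of_isHomogeneous (hf.deg_ne_zero s) (fun _ => hlt.le) (hf.homogeneous s)
  simp only [hlt.ne', Set.ofPred_false, Set.image_empty, Submodule.span_empty,
    Submodule.mem_bot] at hmem
  exact hf.irredundant s (hmem ▸ zero_mem _)

theorem deg_eq (hb : IsMinimalGenerators b fun _ => d) (hf : IsMinimalGenerators f deg) (s : σ) :
    deg s = d := by
  by_contra hs
  have hle : Algebra.adjoin K (Set.range b) ≤ Algebra.adjoin K (f '' {s}ᶜ) := by
    refine Algebra.adjoin_le ?_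
    rintro _ ⟨p, rfl⟩
    have hmem := hf.mem_span_of_isHomogeneous (hb.deg_ne_zero p) (hb.le_deg hf) (hb.homogeneous p)
    refine Algebra.span_le_adjoin K _ (Submodule.span_mono (Set.image_mono ?_) hmem)
    rintro t ht rfl
    exact hs ht
  exact hf.irredundant s (hle (hb.generates ▸ Algebra.mem_top))

theorem linearIndependent (hf : IsMinimalGenerators f deg) : LinearIndependent K f := by
  rw [linearIndependent_iff_notMem_span]
  intro s hs
  rw [← Set.compl_eq_univ_sdiff] at hs
  exact hf.irredundant s (Algebra.span_le_adjoin K _ hs)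

theorem span_range_le (hb : IsMinimalGenerators b fun _ => d)
    (hf : IsMinimalGenerators f fun _ => d) :
    Submodule.span K (Set.range f) ≤ Submodule.span K (Set.range b) := by
  rw [Submodule.span_le]
  rintro _ ⟨s, rfl⟩
  exact Submodule.span_mono (Set.image_subset_range _ _)
    (hb.mem_span_of_isHomogeneous (hf.deg_ne_zero s) (fun _ => le_rfl) (hf.homogeneous s))

theorem span_range_eq (hb : IsMinimalGenerators b fun _ => d)
    (hf : IsMinimalGenerators f fun _ => d) :
    Submodule.span K (Set.range f) = Submodule.span K (Set.range b) :=
  (hb.span_range_le hf).antisymm (hf.span_range_le hb)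

theorem natCard_eq (hb : IsMinimalGenerators b fun _ => d)
    (hf : IsMinimalGenerators f fun _ => d) : Nat.card σ = Nat.card κ :=
  Nat.card_congr ((Module.Basis.span hf.linearIndependent).indexEquiv
    ((Module.Basis.span hb.linearIndependent).map
      (LinearEquiv.ofEq _ _ (hb.span_range_eq hf).symm)))

end IsMinimalGenerators

end MinimalGenerators

section LinearChange

variable {R S σ κ : Type*} [CommRing R] [CommRing S] [Algebra R S] {f : σ → S} {b : κ → S}

theorem aeval_equivMvPolynomial {N : Submodule R S} (c : Module.Basis σ R N)
    (hc : ∀ s, (c s : S) = f s) (y : SymmetricAlgebra R N) :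
    aeval f (SymmetricAlgebra.equivMvPolynomial c y) =
      SymmetricAlgebra.lift N.subtype y := by
  have hcomp : (aeval f).comp
      (SymmetricAlgebra.equivMvPolynomial c : SymmetricAlgebra R N →ₐ[R] MvPolynomial σ R) =
        SymmetricAlgebra.lift N.subtype := by
    refine SymmetricAlgebra.algHom_ext (c.ext fun s => ?_)
    simp [hc]
  exact DFunLike.congr_fun hcomp y

theorem isHomogeneous_equivMvPolynomial_ι {N : Type*} [AddCommGroup N] [Module R N]
    (c : Module.Basis σ R N) (y : N) :
    (SymmetricAlgebra.equivMvPolynomial c (SymmetricAlgebra.ι R N y)).IsHomogeneous 1 := by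
  have hle : Submodule.span R (Set.range c) ≤ (homogeneousSubmodule σ R 1).comap
      ((SymmetricAlgebra.equivMvPolynomial c).toLinearMap ∘ₗ SymmetricAlgebra.ι R N) := by
    rw [Submodule.span_le]
    rintro _ ⟨s, rfl⟩
    simp [isHomogeneous_X]
  exact hle (c.mem_span y)

theorem exists_linearChange (hf : LinearIndependent R f) (hb : LinearIndependent R b)
    (hfb : Submodule.span R (Set.range f) = Submodule.span R (Set.range b)) :
    ∃ ψ : MvPolynomial κ R ≃ₐ[R] MvPolynomial σ R,
      (∀ p, (ψ (X p)).IsHomogeneous 1) ∧ ∀ P, aeval f (ψ P) = aeval b P := by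
  let cf := Module.Basis.span hf
  let cb := (Module.Basis.span hb).map (LinearEquiv.ofEq _ _ hfb.symm)
  refine ⟨(SymmetricAlgebra.equivMvPolynomial cb).symm.trans
    (SymmetricAlgebra.equivMvPolynomial cf), fun p => ?_, fun P => ?_⟩
  · rw [AlgEquiv.trans_apply, SymmetricAlgebra.equivMvPolynomial_symm_X]
    exact isHomogeneous_equivMvPolynomial_ι cf _
  · obtain ⟨y, rfl⟩ := (SymmetricAlgebra.equivMvPolynomial cb).surjective P
    rw [AlgEquiv.trans_apply, AlgEquiv.symm_apply_apply,
      aeval_equivMvPolynomial cf fun s => by simp [cf],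
      aeval_equivMvPolynomial cb fun p => by simp [cb]]

end LinearChange

section ProjectiveDimension

open CategoryTheory

variable {R : Type u} [CommRing R] {J : Ideal R}

theorem eq_bot_of_le_smul_self [IsDomain R] {M : Type*} [AddCommGroup M] [Module R M]
    [Module.IsTorsionFree R M] (hJ : J ≠ ⊤) {N : Submodule R M} (hfg : N.FG) (hN : N ≤ J • N) :
    N = ⊥ := by
  obtain ⟨r, hrJ, hrN⟩ :=
    Submodule.exists_sub_one_mem_and_smul_eq_zero_of_fg_of_le_smul J N hfg hN
  have hr : r ≠ 0 := by
    rintro rfl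
    rw [zero_sub, neg_mem_iff, ← Ideal.eq_top_iff_one] at hrJ
    exact hJ hrJ
  exact (Submodule.eq_bot_iff N).2 fun x hx => (smul_eq_zero.1 (hrN x hx)).resolve_left hr

theorem range_le_smul_range_of_projective {F F' M : Type*} [AddCommGroup F] [Module R F]
    [AddCommGroup F'] [Module R F'] [AddCommGroup M] [Module R M] [Module.Projective R M]
    {d : F' →ₗ[R] F} {p : F →ₗ[R] M} (hd : Function.Exact d p) (hp : Function.Surjective p)
    (hmin : LinearMap.range d ≤ J • ⊤) : LinearMap.range d ≤ J • LinearMap.range d := by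
  obtain ⟨s, hs⟩ := Module.projective_lifting_property p LinearMap.id hp
  have hs (m : M) : p (s m) = m := LinearMap.congr_fun hs m
  let ρ : F →ₗ[R] F := LinearMap.id - s ∘ₗ p
  have hρ_range : ⊤ ≤ (LinearMap.range d).comap ρ := fun v _ =>
    (hd (ρ v)).1 (by simp [ρ, hs])
  have hρ_fix (v : F) (hv : v ∈ LinearMap.range d) : ρ v = v := by
    simp [ρ, (hd v).2 hv]
  intro v hv
  rw [← hρ_fix v hv]
  have hmem := Submodule.mem_map_of_mem (f := ρ) (hmin hv)
  rw [Submodule.map_smul''] at hmem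
  exact Submodule.smul_mono le_rfl (Submodule.map_le_iff_le_comap.2 hρ_range) hmem

theorem hasProjectiveDimensionLT_iff_ker {F M : Type u} [AddCommGroup F] [Module R F]
    [AddCommGroup M] [Module R M] [Module.Projective R F] {p : F →ₗ[R] M}
    (hp : Function.Surjective p) (n : ℕ) :
    HasProjectiveDimensionLT (ModuleCat.of R M) (n + 2) ↔
      HasProjectiveDimensionLT (ModuleCat.of R (LinearMap.ker p)) (n + 1) :=
  (LinearMap.shortExact_shortComplexKer hp).hasProjectiveDimensionLT_X₃_iff n
    ((IsProjective.iff_projective F).1 inferInstance)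

variable {F : ℕ → Type u} [∀ i, AddCommGroup (F i)] [∀ i, Module R (F i)]
  [∀ i, Module.Projective R (F i)] [∀ i, Module.Finite R (F i)] [IsDomain R]
  {d : ∀ i, F (i + 1) →ₗ[R] F i} {M : Type u} [AddCommGroup M] [Module R M] {p : F 0 →ₗ[R] M}

theorem projective_iff_subsingleton_of_minimal (hJ : J ≠ ⊤)
    (hexact : ∀ i, Function.Exact (d (i + 1)) (d i)) (hp_exact : Function.Exact (d 0) p)
    (hp : Function.Surjective p) (hmin : ∀ i, LinearMap.range (d i) ≤ J • ⊤) :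
    Module.Projective R M ↔ Subsingleton (F 1) := by
  constructor
  · intro _
    have hrange : LinearMap.range (d 0) = ⊥ :=
      eq_bot_of_le_smul_self hJ (LinearMap.range_eq_map (d 0) ▸ Module.Finite.fg_top.map _)
        (range_le_smul_range_of_projective hp_exact hp (hmin 0))
    have hker : LinearMap.range (d 1) = ⊤ := by
      rw [← (hexact 0).linearMap_ker_eq, LinearMap.range_eq_bot.1 hrange, LinearMap.ker_zero]
    have htop : (⊤ : Submodule R (F 1)) = ⊥ :=
      eq_bot_of_le_smul_self hJ Module.Finite.fg_top (hker ▸ hmin 1)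
    exact (Submodule.subsingleton_iff R).1 (subsingleton_of_bot_eq_top htop.symm)
  · intro _
    have hinj : Function.Injective p := by
      rw [← LinearMap.ker_eq_bot, hp_exact.linearMap_ker_eq, LinearMap.range_eq_bot]
      exact Subsingleton.elim _ _
    exact Module.Projective.of_equiv (LinearEquiv.ofBijective p ⟨hinj, hp⟩)

theorem hasProjectiveDimensionLT_succ_iff_subsingleton (hJ : J ≠ ⊤) (n : ℕ)
    (hexact : ∀ i, Function.Exact (d (i + 1)) (d i)) (hp_exact : Function.Exact (d 0) p)
    (hp : Function.Surjective p) (hmin : ∀ i, LinearMap.range (d i) ≤ J • ⊤) :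
    HasProjectiveDimensionLT (ModuleCat.of R M) (n + 1) ↔ Subsingleton (F (n + 1)) := by
  induction n generalizing F M with
  | zero =>
    rw [zero_add, ← projective_iff_hasProjectiveDimensionLT_one, ← IsProjective.iff_projective]
    exact projective_iff_subsingleton_of_minimal hJ hexact hp_exact hp hmin
  | succ n ih =>
    rw [hasProjectiveDimensionLT_iff_ker hp, hp_exact.linearMap_ker_eq]
    have hrestrict : Function.Exact (d 1) (d 0).rangeRestrict := fun v => by
      rw [← hexact 0 v]
      exact Subtype.ext_iff
    exact ih (F := fun i => F (i + 1)) (fun i => hexact (i + 1)) hrestrict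
      (LinearMap.surjective_rangeRestrict _) fun i => hmin (i + 1)

end ProjectiveDimension

section MinimalResolutions

theorem idealOfVars_ne_top {R σ : Type*} [CommRing R] [Nontrivial R] : idealOfVars σ R ≠ ⊤ := by
  intro h
  have hone := C_mem_pow_idealOfVars_iff (σ := σ) (R := R) 1 1
  simp [h] at hone

theorem mem_smul_top_of_forall_mem {R ι : Type*} [CommRing R] [Finite ι] {J : Ideal R}
    {v : ι → R} (hv : ∀ i, v i ∈ J) : v ∈ J • (⊤ : Submodule R (ι → R)) := by
  classical
  have := Fintype.ofFinite ι
  rw [pi_eq_sum_univ' v]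
  exact sum_mem fun i _ => Submodule.smul_mem_smul (hv i) Submodule.mem_top

theorem MinimalGradedFreeResolution.projectiveDimension_eq {K : Type u} [Field K] {σ : Type v}
    {w : σ → ℤ} {M : Type max v u} [AddCommGroup M] [Module (MvPolynomial σ K) M]
    {gr : ℤ → Set M} (F : MinimalGradedFreeResolution (K := K) w M gr) {n : ℕ}
    (hn : F.rank (n + 1) ≠ 0) (hn' : F.rank (n + 2) = 0) :
    CategoryTheory.projectiveDimension (ModuleCat.of (MvPolynomial σ K) M) = (n + 1 : ℕ) := by
  have hmin (i : ℕ) : LinearMap.range (F.d i) ≤ idealOfVars σ K • ⊤ := by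
    rintro _ ⟨v, rfl⟩
    exact mem_smul_top_of_forall_mem (F.minimal i v)
  have hLT (i : ℕ) := hasProjectiveDimensionLT_succ_iff_subsingleton idealOfVars_ne_top i
    F.exact_d F.exact_aug F.aug_surjective hmin
  have : NeZero (F.rank (n + 1)) := ⟨hn⟩
  have : IsEmpty (Fin (F.rank (n + 2))) := hn' ▸ Fin.isEmpty
  refine le_antisymm ((CategoryTheory.projectiveDimension_le_iff _ _).2 ((hLT _).2 inferInstance))
    ((CategoryTheory.projectiveDimension_ge_iff _ _).2 fun h => ?_)
  exact not_subsingleton _ ((hLT n).1 h)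

end MinimalResolutions

section PfaffianResolution

variable {K : Type u} [Field K] {σ : Type*}

/-- A presentation `K[σ] → A`, given by `f`, of an algebra by the sub-Pfaffians of a skew-symmetric
matrix of linear forms `x`, for which the Pfaffian complex is exact: this is what the minimal
resolution of `A` is built from. -/
structure IsPfaffianPresentation {A : Type*} [CommRing A] [Algebra K A] (f : σ → A)
    (x : Pair → MvPolynomial σ K) : Prop where
  surjective : Function.Surjective (aeval f : MvPolynomial σ K →ₐ[K] A)
  ker_eq : RingHom.ker (aeval f : MvPolynomial σ K →ₐ[K] A) =
    Ideal.span (Set.range (signedPfaffian x))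
  isHomogeneous : ∀ p, (x p).IsHomogeneous 1
  exact_row : ExactModulo ⊥ (skewMatrix x) (replicateRow (Fin 1) (signedPfaffian x))
  exact_skew : ExactModulo ⊥ (replicateCol (Fin 1) (signedPfaffian x)) (skewMatrix x)
  signedPfaffian_ne_zero : signedPfaffian x 0 ≠ 0

/-- The ranks `1, 5, 5, 1` of the terms of the Pfaffian resolution. -/
def pfaffianRank : ℕ → ℕ
  | 0 => 1
  | 1 => 5
  | 2 => 5
  | 3 => 1
  | _ + 4 => 0

/-- The twists `0, 4, 6, 10` of the terms of the Pfaffian resolution, for variables of degree `2`;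
the terms from the fifth on are zero, so that their twist is irrelevant. -/
def pfaffianTwist : ℕ → ℤ
  | 0 => 0
  | 1 => 4
  | 2 => 6
  | 3 => 10
  | _ + 4 => 0

/-- The differentials of the Pfaffian resolution: the row of the sub-Pfaffians, the skew-symmetric
matrix, the column of the sub-Pfaffians. -/
def pfaffianDifferential {R : Type*} [CommRing R] (x : Pair → R) :
    ∀ i, (Fin (pfaffianRank (i + 1)) → R) →ₗ[R] (Fin (pfaffianRank i) → R)
  | 0 => (replicateRow (Fin 1) (signedPfaffian x)).mulVecLin
  | 1 => (skewMatrix x).mulVecLin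
  | 2 => (replicateCol (Fin 1) (signedPfaffian x)).mulVecLin
  | _ + 3 => 0

/-- The augmentation `R → A` of the module structure `moduleVia f`; its source is written as the
free module `R^1`, the term of a resolution. -/
def augmentation {A : Type*} [CommRing A] [Algebra K A] (f : σ → A) :
    letI : Module (MvPolynomial σ K) A := moduleVia f
    (Fin 1 → MvPolynomial σ K) →ₗ[MvPolynomial σ K] A :=
  letI : Module (MvPolynomial σ K) A := moduleVia f
  { toFun := fun v => aeval f (v 0)
    map_add' := fun v w => map_add (aeval f) (v 0) (w 0)
    map_smul' := fun r v => map_mul (aeval f) r (v 0) }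

theorem augmentation_apply {A : Type*} [CommRing A] [Algebra K A] (f : σ → A)
    (v : Fin 1 → MvPolynomial σ K) : augmentation f v = aeval f (v 0) := rfl

theorem replicateCol_mulVecLin_injective {R ι : Type*} [CommRing R] [IsDomain R] {c : ι → R}
    {i : ι} (hc : c i ≠ 0) : Function.Injective (replicateCol (Fin 1) c).mulVecLin := by
  rw [injective_iff_map_eq_zero]
  intro v hv
  have hi : c i * v 0 = 0 := by
    simpa [mulVec, dotProduct] using congrFun hv i
  funext j
  rw [Subsingleton.elim j 0]
  exact (mul_eq_zero.1 hi).resolve_left hc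

theorem isWeightedHomogeneous_const_of_isHomogeneous {R : Type*} [CommSemiring R]
    {P : MvPolynomial σ R} {n : ℕ} (hP : P.IsHomogeneous n) (k : ℤ) :
    IsWeightedHomogeneous (fun _ => k) P (n * k) := by
  intro m hm
  rw [← hP hm]
  simp [Finsupp.weight_apply, Finsupp.sum, Finset.sum_mul]

theorem mem_idealOfVars_of_isHomogeneous {R : Type*} [CommSemiring R] {P : MvPolynomial σ R}
    {n : ℕ} (hn : n ≠ 0) (hP : P.IsHomogeneous n) : P ∈ idealOfVars σ R := by
  rw [← pow_one (idealOfVars σ R), mem_pow_idealOfVars_iff']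
  intro m hm
  refine hP.coeff_eq_zero ?_
  omega

theorem mulVec_mem_freeDegree {m n : ℕ} {w : σ → ℤ} {M : Matrix (Fin m) (Fin n) (MvPolynomial σ K)}
    {a b c : ℤ} (hM : ∀ i j, IsWeightedHomogeneous w (M i j) c) (habc : c + a = b) (k : ℤ)
    {v : Fin n → MvPolynomial σ K} (hv : v ∈ freeDegree w (fun _ => b) k) :
    M *ᵥ v ∈ freeDegree w (fun _ => a) k := by
  intro i
  refine IsWeightedHomogeneous.sum _ _ _ fun j _ => ?_
  have hmul := (hM i j).mul (hv j)
  rwa [show c + (k - b) = k - a by omega] at hmul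

theorem mulVec_apply_mem {R ι κ : Type*} [CommRing R] [Fintype κ] {J : Ideal R}
    {M : Matrix ι κ R} (hM : ∀ i j, M i j ∈ J) (v : κ → R) (i : ι) : (M *ᵥ v) i ∈ J :=
  sum_mem fun j _ => J.mul_mem_right _ (hM i j)

theorem augmentation_mem_algebraDegree {τ : Type*} {A : Subalgebra K (MvPolynomial τ K)}
    {f : σ → A} {d : ℕ} (hf : ∀ s, (f s : MvPolynomial τ K).IsHomogeneous d) {n : ℤ}
    {v : Fin 1 → MvPolynomial σ K} (hv : v ∈ freeDegree (fun _ => (d : ℤ)) (fun _ => 0) n) :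
    augmentation f v ∈ algebraDegree A n := by
  refine isWeightedHomogeneous_coe_aeval (w := fun _ => (d : ℤ)) (fun s => ?_) ?_
  · simpa using isWeightedHomogeneous_const_of_isHomogeneous (hf s) 1
  · simpa using hv 0

namespace IsPfaffianPresentation

variable {A : Type*} [CommRing A] [Algebra K A] {f : σ → A} {x : Pair → MvPolynomial σ K}

theorem exact_augmentation (hx : IsPfaffianPresentation f x) :
    Function.Exact (replicateRow (Fin 1) (signedPfaffian x)).mulVecLin (augmentation f) := by
  intro v
  rw [augmentation_apply, ← RingHom.mem_ker, hx.ker_eq, Ideal.mem_span_range_iff_exists_fun]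
  refine exists_congr fun u => ?_
  rw [← replicateRow_mulVec_apply _ _ 0]
  exact ⟨fun h => funext fun i => Subsingleton.elim (0 : Fin 1) i ▸ h, fun h => congrFun h 0⟩

theorem exact_differential (hx : IsPfaffianPresentation f x) :
    ∀ i, Function.Exact (pfaffianDifferential x (i + 1)) (pfaffianDifferential x i)
  | 0 => hx.exact_row.function_exact (replicateRow_signedPfaffian_mul_skewMatrix x)
  | 1 => hx.exact_skew.function_exact (skewMatrix_mul_replicateCol_signedPfaffian x)
  | 2 => (LinearMap.exact_zero_iff_injective _ _).2
      (replicateCol_mulVecLin_injective hx.signedPfaffian_ne_zero)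
  | _ + 3 => fun _ => ⟨fun _ => ⟨0, Subsingleton.elim (α := Fin 0 → _) _ _⟩, fun _ => rfl⟩

theorem differential_mem_idealOfVars (hx : IsPfaffianPresentation f x) :
    ∀ i v a, pfaffianDifferential x i v a ∈ idealOfVars σ K
  | 0, v, a => mulVec_apply_mem (fun _ j => mem_idealOfVars_of_isHomogeneous two_ne_zero
      (isWeightedHomogeneous_signedPfaffian hx.isHomogeneous j)) v a
  | 1, v, a => mulVec_apply_mem (fun i j => mem_idealOfVars_of_isHomogeneous one_ne_zero
      (isWeightedHomogeneous_skewMatrix hx.isHomogeneous i j)) v a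
  | 2, v, a => mulVec_apply_mem (fun i _ => mem_idealOfVars_of_isHomogeneous two_ne_zero
      (isWeightedHomogeneous_signedPfaffian hx.isHomogeneous i)) v a
  | _ + 3, _, _ => zero_mem _

theorem differential_mapsTo_freeDegree (hx : IsPfaffianPresentation f x) (i : ℕ) (n : ℤ) :
    Set.MapsTo (pfaffianDifferential x i)
      (freeDegree (fun _ => 2) (fun _ => pfaffianTwist (i + 1)) n)
      (freeDegree (fun _ => 2) (fun _ => pfaffianTwist i) n) := by
  have hdeg (p : Pair) : IsWeightedHomogeneous (fun _ => (2 : ℤ)) (x p) 2 := by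
    simpa using isWeightedHomogeneous_const_of_isHomogeneous (hx.isHomogeneous p) 2
  match i with
  | 0 => exact fun _ hv =>
      mulVec_mem_freeDegree (fun _ j => isWeightedHomogeneous_signedPfaffian hdeg j) rfl n hv
  | 1 => exact fun _ hv =>
      mulVec_mem_freeDegree (isWeightedHomogeneous_skewMatrix hdeg) rfl n hv
  | 2 => exact fun _ hv =>
      mulVec_mem_freeDegree (fun i _ => isWeightedHomogeneous_signedPfaffian hdeg i) rfl n hv
  | _ + 3 => exact fun _ _ _ => isWeightedHomogeneous_zero _ _ _

/-- The Pfaffian resolution of a graded algebra generated in degree `2`. -/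
def resolution {τ : Type*} {A : Subalgebra K (MvPolynomial τ K)} {f : σ → A}
    (hx : IsPfaffianPresentation f x) (hf : ∀ s, (f s : MvPolynomial τ K).IsHomogeneous 2) :
    letI : Module (MvPolynomial σ K) A := moduleVia f
    MinimalGradedFreeResolution (K := K) (fun _ : σ => ((2 : ℕ) : ℤ)) A (algebraDegree A) :=
  letI : Module (MvPolynomial σ K) A := moduleVia f
  { rank := pfaffianRank
    twist := fun i _ => pfaffianTwist i
    d := pfaffianDifferential x
    aug := augmentation f
    d_graded := hx.differential_mapsTo_freeDegree
    aug_graded := fun _ _ => augmentation_mem_algebraDegree hf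
    exact_d := hx.exact_differential
    exact_aug := hx.exact_augmentation
    aug_surjective := fun y => (hx.surjective y).imp' (fun P _ => P) fun _ => id
    minimal := hx.differential_mem_idealOfVars }

end IsPfaffianPresentation

theorem isPfaffianPresentation_brackets [Infinite K] :
    IsPfaffianPresentation (brackets K) (X : Pair → MvPolynomial Pair K) where
  surjective := aeval_brackets_surjective
  ker_eq := by rw [ker_aeval_brackets, ← sectionIdeal_empty_eq_span_plucker, sectionIdeal_empty]
  isHomogeneous := isHomogeneous_X K
  exact_row := by simpa using exactModulo_skewMatrix_X (R := K) (Set.empty_subset _)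
  exact_skew := by simpa using exactModulo_replicateCol_X (R := K) (Set.empty_subset _)
  signedPfaffian_ne_zero h0 := plucker_notMem (K := K) 0 <| by
    rw [plucker_eq, h0, mul_zero]
    exact zero_mem _

theorem IsPfaffianPresentation.linearChange {κ A : Type*} [CommRing A] [Algebra K A] {b : κ → A}
    {f : σ → A} {x : Pair → MvPolynomial κ K} (hx : IsPfaffianPresentation b x)
    {ψ : MvPolynomial κ K ≃ₐ[K] MvPolynomial σ K} (hψ : ∀ p, (ψ (X p)).IsHomogeneous 1)
    (hfψ : ∀ P, aeval f (ψ P) = aeval b P) : IsPfaffianPresentation f (ψ ∘ x) := by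
  have hψx : ψ.symm ∘ ψ ∘ x = x := funext fun p => ψ.symm_apply_apply (x p)
  constructor
  case surjective => exact fun y => (hx.surjective y).imp' ψ fun P hP => (hfψ P).trans hP
  case ker_eq =>
    ext P
    obtain ⟨P, rfl⟩ := ψ.surjective P
    rw [RingHom.mem_ker, hfψ, ← RingHom.mem_ker, hx.ker_eq, ← comp_signedPfaffian, Set.range_comp,
      ← Ideal.map_span, Ideal.mem_map_of_equiv]
    simp
  case isHomogeneous =>
    intro p
    have hψX : ψ (x p) = aeval (fun q => ψ (X q)) (x p) :=
      DFunLike.congr_fun (aeval_unique (ψ : MvPolynomial κ K →ₐ[K] MvPolynomial σ K)) (x p)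
    rw [Function.comp_apply, hψX]
    exact (hx.isHomogeneous p).aeval _ hψ
  case exact_row =>
    refine .bot_of_map ψ.symm.bijective ?_
    rw [skewMatrix_map, replicateRow_signedPfaffian_map, hψx]
    exact hx.exact_row
  case exact_skew =>
    refine .bot_of_map ψ.symm.bijective ?_
    rw [skewMatrix_map, replicateCol_signedPfaffian_map, hψx]
    exact hx.exact_skew
  case signedPfaffian_ne_zero =>
    rw [← comp_signedPfaffian]
    exact (map_ne_zero_iff ψ ψ.injective).2 hx.signedPfaffian_ne_zero

end PfaffianResolution

end FiveLinearForms

end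

theorem mainTheorem7_general (K : Type*) [Field K] [Infinite K] :
    IsMinimalGenerators (brackets K) (fun _ => 2) ∧
    (RingHom.ker (aeval (brackets K) : MvPolynomial Pair K →ₐ[K] invariants K 5)
        = Ideal.span (Set.range (plucker K)) ∧
      ∀ h, plucker K h ∉ Ideal.span (plucker K '' {h}ᶜ)) ∧
    ∀ (σ : Type) (f : σ → invariants K 5) (deg : σ → ℕ), IsMinimalGenerators f deg →
      Nat.card σ = 10 ∧ (∀ s, deg s = 2) ∧
      letI : Module (MvPolynomial σ K) (invariants K 5) := moduleVia f
      (∃ F : MinimalGradedFreeResolution (K := K) (fun s => (deg s : ℤ)) (invariants K 5)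
          (algebraDegree (invariants K 5)),
        F.TermIs 0 0 1 ∧ F.TermIs 1 4 5 ∧ F.TermIs 2 6 5 ∧ F.TermIs 3 10 1 ∧
        (∀ i, 4 ≤ i → F.rank i = 0) ∧
        ∀ a r, F.aug (Pi.single a r) = aeval f r) ∧
      CategoryTheory.projectiveDimension
        (ModuleCat.of (MvPolynomial σ K) (invariants K 5)) = 3 := by
  have hb := isMinimalGenerators_brackets (K := K)
  refine ⟨hb, ⟨ker_aeval_brackets, plucker_notMem⟩, fun σ f deg hf => ?_⟩
  obtain rfl : deg = fun _ => 2 := funext (hb.deg_eq hf)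
  obtain ⟨ψ, hψ, hfψ⟩ := exists_linearChange hf.linearIndependent hb.linearIndependent
    (hb.span_range_eq hf)
  have hx := isPfaffianPresentation_brackets.linearChange hψ hfψ
  have hcard : Nat.card σ = 10 := by
    rw [hb.natCard_eq hf, Nat.card_eq_fintype_card]
    rfl
  let : Module (MvPolynomial σ K) (invariants K 5) := moduleVia f
  let F := hx.resolution hf.homogeneous
  refine ⟨hcard, fun _ => rfl, ⟨F, ⟨rfl, fun _ => rfl⟩, ⟨rfl, fun _ => rfl⟩, ⟨rfl, fun _ => rfl⟩,
    ⟨rfl, fun _ => rfl⟩, ?_, fun a r => ?_⟩,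
    F.projectiveDimension_eq (n := 2) one_ne_zero rfl⟩
  · exact fun
      | _ + 4, _ => rfl
  · obtain rfl : a = (0 : Fin 1) := Subsingleton.elim (α := Fin 1) _ _
    exact congrArg (aeval f) (Pi.single_eq_same (M := fun _ : Fin 1 => MvPolynomial σ K) 0 r)

theorem mainTheorem7 (K : Type*) [Field K] [CharZero K] :
    -- the ten brackets are a minimal system of generators, of degree 2
    IsMinimalGenerators (brackets K) (fun _ => 2) ∧
    -- their relations are generated, irredundantly, by the five Plücker relations
    (RingHom.ker (aeval (brackets K) : MvPolynomial Pair K →ₐ[K] invariants K 5)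
        = Ideal.span (Set.range (plucker K)) ∧
      ∀ h, plucker K h ∉ Ideal.span (plucker K '' {h}ᶜ)) ∧
    -- the minimal resolution, for every minimal system of homogeneous generators
    ∀ (σ : Type) [Finite σ] (f : σ → invariants K 5) (deg : σ → ℕ), IsMinimalGenerators f deg →
      Nat.card σ = 10 ∧ (∀ s, deg s = 2) ∧
      letI : Module (MvPolynomial σ K) (invariants K 5) := moduleVia f
      (∃ F : MinimalGradedFreeResolution (K := K) (fun s => (deg s : ℤ)) (invariants K 5)
          (algebraDegree (invariants K 5)),
        F.TermIs 0 0 1 ∧ F.TermIs 1 4 5 ∧ F.TermIs 2 6 5 ∧ F.TermIs 3 10 1 ∧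
        (∀ i, 4 ≤ i → F.rank i = 0) ∧
        ∀ a r, F.aug (Pi.single a r) = aeval f r) ∧
      CategoryTheory.projectiveDimension
        (ModuleCat.of (MvPolynomial σ K) (invariants K 5)) = 3 := by
  have : Infinite K := Infinite.of_injective _ Nat.cast_injective
  obtain ⟨hbrackets, hplucker, hresolution⟩ := mainTheorem7_general K
  exact ⟨hbrackets, hplucker, fun σ _ => hresolution σ⟩
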